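/- Let $0<q\le 1$, and let $\mathbb H\subset\mathbb C\cup\{\infty\}$ be the upper half plane inside the Riemann sphere. **$q$-rationals.** Let $\sigma_{1,q}=\begin{bmatrix}q^{-1}&-q^{-1}\\0&1\end{bmatrix}$ and $\sigma_{2,q}=\begin{bmatrix}1&0\\1&q^{-1}\end{bmatrix}$ act on $\mathbb R\cup\{\infty\}$ by fractional linear transformations. Each $x\in\mathbb Q\cup\{\infty\}$ has an even continued fraction expansion $[a_1,\dots,a_{2n}]$: the empty one for $x=\infty$, $[-1,1]$ for $x=0$, and otherwise the unique one of even length, with value $a_1+\cfrac{1}{a_2+\cdots}=x$, such that either $a_1\ge0$ and $a_2,\dots,a_{2n}\ge1$, or $-a_1\ge0$ and $-a_2,\dots,-a_{2n}\ge1$. Put $\beta_x=\sigma_{1,q}^{-a_1}\sigma_{2,q}^{a_2}\cdots\sigma_{1,q}^{-a_{2n-1}}\sigma_{2,q}^{a_{2n}}$, and let $$[x]_q^\flat=\beta_x\Big(\frac1{1-q}\Big),\qquad [x]_q^\sharp=\beta_x(\infty)$$ (with $\frac1{1-q}=\infty$ for $q=1$) be the left and right $q$-deformed rationals of $x$. The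 $q$-deformed rational curve of $x$ is the hyperbolic geodesic of $\mathbb H$ joining $[x]_q^\flat$ and $[x]_q^\sharp$ (empty if the two coincide). Let $\mathbb Q_q\subset\mathbb C\cup\{\infty\}$ be the union of all these curves together with their endpoints. **$q$-irrationals.** For irrational $t\in\mathbb R$ let $[t]_q\in\mathbb R$ be the limit of $[r]_q^\sharp$ as $r\to t$ through the rational numbers, and let $\mathbb I_q=\{[t]_q: t\in\mathbb R\setminus\mathbb Q\}$. **$q$-deformed Farey tessellation.** Start with the geodesic from $0$ to $\infty$ with label $q^{-1}$, viewed once as an edge with left vertex $\frac01$ and right vertex $\frac10$, and once as an edge with left vertex $\frac{-1}{0}$ and right vertex $\frac0q$. To each edge with left vertex $\frac RS$, right vertex $\frac{R'}{S'}$ and label $q^{k-1}$, attach the ideal triangle with third vertex $\frac{R+q^kR'}{S+q^kS'}$; its new left edge, from $\frac RS$ to the third vertex, has label $1$, and its new right edge, from the third vertex to $\frac{R'}{S'}$, has label $q^k$. Iterate. Let $L_q\subseteq\mathbb H$ be the union of all the resulting closed ideal triangles (with their sides, without their ideal vertices). **Proposition.** 1. $L_q$ is homeomorphic to an open disk, and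 $L_q\ne\mathbb H$ if $q<1$. 2. The boundary $\partial\overline{L}_q$ of the closure $\overline L_q$ of $L_q$ in $\mathbb C\cup\{\infty\}$ equals the disjoint union $\mathbb Q_q\sqcup\mathbb I_q$. Here $\partial\overline L_q$ may be read either as the topological frontier of $\overline L_q$ or as $\overline L_q\setminus L_q$. 3. With the subspace topology from $\mathbb C\cup\{\infty\}$, there is a homeomorphism $\mathbb Q_q\sqcup\mathbb I_q\to\mathbb R\cup\{\infty\}$ that restricts to the identity on the left and right $q$-deformed rationals and on the $q$-deformed irrationals. In particular $\partial\overline L_q$ is homeomorphic to $\mathbb R\cup\{\infty\}$. 4. $\mathbb Q_q$ is a dense subset of $\partial\overline L_q$. -/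

import Mathlib

open Set Filter Topology OnePoint
open scoped UpperHalfPlane

noncomputable section

namespace QFarey

/-! ### Even continued fraction expansions of elements of `ℚ ∪ {∞}` -/

/-- The value `a₁ + 1 / (a₂ + 1 / (⋯ + 1 / aₘ))` of a nonempty finite continued fraction
(the convention `0⁻¹ = 0` makes the value of `[a]` equal to `a`). -/
def cfValue : List ℤ → ℚ
  | [] => 0
  | a :: l => a + (cfValue l)⁻¹

/-- `l = [a₁, a₂, …]` is nonempty with `a₁ ≥ 0` and `a₂, a₃, … ≥ 1`. -/
def IsPosCF : List ℤ → Prop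
  | [] => False
  | a :: l => 0 ≤ a ∧ ∀ b ∈ l, 1 ≤ b

/-- `IsEvenCF l x`: the list `l` is the even continued fraction expansion of `x ∈ ℚ ∪ {∞}`.
The expansion of `∞` is empty, that of `0` is `[-1, 1]`, and that of any other rational number is
the one of even length in which either `a₁ ≥ 0` and `a₂, a₃, … ≥ 1`, or `-a₁ ≥ 0` and
`-a₂, -a₃, … ≥ 1`. -/
def IsEvenCF (l : List ℤ) : OnePoint ℚ → Prop
  | ∞ => l = []
  | (r : ℚ) =>
      if r = 0 then l = [-1, 1]
      else Even l.length ∧ (IsPosCF l ∨ IsPosCF (l.map (fun a => -a))) ∧ cfValue l = r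

theorem cfValue_map_neg (l : List ℤ) : cfValue (l.map (fun a => -a)) = -cfValue l := by
  induction l with
  | nil => simp [cfValue]
  | cons a l ih =>
    simp only [List.map_cons, cfValue, ih, Int.cast_neg, inv_neg]
    ring

theorem exists_cf_of_one_lt (n : ℕ) : ∀ (x : ℚ), 1 < x → x.den ≤ n →
    (∃ l : List ℤ, Even l.length ∧ (∀ b ∈ l, 1 ≤ b) ∧ cfValue l = x) ∧
    (∃ l : List ℤ, ¬ Even l.length ∧ (∀ b ∈ l, 1 ≤ b) ∧ cfValue l = x) := by
  induction n with
  | zero =>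
    intro x _ hn
    exact absurd (Nat.le_zero.mp hn) x.den_nz
  | succ n ih =>
    intro x hx hn
    have hfl : (1 : ℤ) ≤ ⌊x⌋ := Int.le_floor.mpr (by exact_mod_cast hx.le)
    by_cases hfr : Int.fract x = 0
    · have hxf : (⌊x⌋ : ℚ) = x := by
        have := Int.floor_add_fract x
        rw [hfr, add_zero] at this
        exact this
      have h2 : (2 : ℤ) ≤ ⌊x⌋ := by
        have : (1 : ℚ) < (⌊x⌋ : ℚ) := by rw [hxf]; exact hx
        have : (1 : ℤ) < ⌊x⌋ := by exact_mod_cast this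
        omega
      refine ⟨⟨[⌊x⌋ - 1, 1], ⟨1, rfl⟩, ?_, ?_⟩, ⟨[⌊x⌋], by simp, ?_, ?_⟩⟩
      · intro b hb
        simp only [List.mem_cons, List.not_mem_nil, or_false] at hb
        omega
      · simp [cfValue, hxf]
      · intro b hb
        simp only [List.mem_cons, List.not_mem_nil, or_false] at hb
        omega
      · simp [cfValue, hxf]
    · have hpos : 0 < Int.fract x := lt_of_le_of_ne (Int.fract_nonneg x) (Ne.symm hfr)
      have hlt : Int.fract x < 1 := Int.fract_lt_one x
      have hy : 1 < (Int.fract x)⁻¹ := (one_lt_inv₀ hpos).mpr hlt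
      have hden : (Int.fract x)⁻¹.den ≤ n := by
        have h1 : (Int.fract x)⁻¹.den < x.den := by
          have hd : (Int.fract x).den = x.den := by
            have hx' : Int.fract x = x - (⌊x⌋ : ℤ) := rfl
            rw [hx', Rat.sub_intCast_den]
          have hnum : (Int.fract x).num < (Int.fract x).den := 
            Rat.num_lt_denom_iff.mpr hlt
          have hnp : 0 < (Int.fract x).num := Rat.num_pos.mpr hpos
          rw [Rat.den_inv_of_ne_zero hpos.ne', ← hd]
          omega
        omega
      have hval : ∀ l : List ℤ, cfValue l = (Int.fract x)⁻¹ → cfValue (⌊x⌋ :: l) = x := by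
        intro l hl
        simp only [cfValue, hl, inv_inv]
        exact Int.floor_add_fract x
      obtain ⟨⟨l, h1, h2, h3⟩, ⟨m, k1, k2, k3⟩⟩ := ih _ hy hden
      refine ⟨⟨⌊x⌋ :: m, ?_, ?_, hval m k3⟩, ⟨⌊x⌋ :: l, ?_, ?_, hval l h3⟩⟩
      · rw [List.length_cons, Nat.even_add_one]; exact k1
      · intro b hb
        rcases List.mem_cons.mp hb with rfl | hb
        · exact hfl
        · exact k2 b hb
      · rw [List.length_cons, Nat.even_add_one, not_not]; exact h1
      · intro b hb
        rcases List.mem_cons.mp hb with rfl | hb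
        · exact hfl
        · exact h2 b hb

theorem exists_posCF (x : ℚ) (hx : 0 < x) :
    ∃ l : List ℤ, Even l.length ∧ IsPosCF l ∧ cfValue l = x := by
  rcases lt_trichotomy x 1 with h | h | h
  · have hy : 1 < x⁻¹ := (one_lt_inv₀ hx).mpr h
    obtain ⟨_, l, h1, h2, h3⟩ := exists_cf_of_one_lt _ _ hy le_rfl
    refine ⟨0 :: l, ?_, ⟨le_rfl, h2⟩, by simp [cfValue, h3]⟩
    rw [List.length_cons, Nat.even_add_one]; exact h1
  · exact ⟨[0, 1], by decide, ⟨le_rfl, by simp⟩, by simp [cfValue, h]⟩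
  · obtain ⟨⟨l, h1, h2, h3⟩, _⟩ := exists_cf_of_one_lt _ _ h le_rfl
    refine ⟨l, h1, ?_, h3⟩
    cases l with
    | nil => simp [cfValue] at h3; linarith
    | cons a l =>
      exact ⟨le_trans zero_le_one (h2 a (by simp)), fun b hb => h2 b (by simp [hb])⟩

theorem exists_isEvenCF (x : OnePoint ℚ) : ∃ l : List ℤ, IsEvenCF l x := by
  induction x using OnePoint.rec with
  | infty => exact ⟨[], rfl⟩
  | coe r =>
    rcases lt_trichotomy r 0 with h | h | h
    · obtain ⟨l, h1, h2, h3⟩ := exists_posCF (-r) (by linarith)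
      refine ⟨l.map (fun a => -a), ?_⟩
      change if r = 0 then _ else _
      rw [if_neg h.ne]
      refine ⟨by simpa using h1, Or.inr (by simpa [Function.comp_def] using h2), ?_⟩
      rw [cfValue_map_neg, h3, neg_neg]
    · refine ⟨[-1, 1], ?_⟩
      change if r = 0 then _ else _
      rw [if_pos h]
    · obtain ⟨l, h1, h2, h3⟩ := exists_posCF r h
      refine ⟨l, ?_⟩
      change if r = 0 then _ else _
      rw [if_neg h.ne']
      exact ⟨h1, Or.inl h2, h3⟩

/-- The even continued fraction expansion of an element of `ℚ ∪ {∞}`. -/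
def evenCF (x : OnePoint ℚ) : List ℤ := (exists_isEvenCF x).choose

/-! ### The deformed modular group and the deformed rationals -/

/-- The matrix `σ_{1,q} = [q⁻¹, -q⁻¹; 0, 1]` (only used for `q ≠ 0`). -/
def sigma1 (q : ℝ) : GL (Fin 2) ℝ :=
  if h : q ≠ 0 then
    Matrix.GeneralLinearGroup.mkOfDetNeZero !![q⁻¹, -q⁻¹; 0, 1] (by simpa [Matrix.det_fin_two] using h)
  else 1

/-- The matrix `σ_{2,q} = [1, 0; 1, q⁻¹]` (only used for `q ≠ 0`). -/
def sigma2 (q : ℝ) : GL (Fin 2) ℝ :=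
  if h : q ≠ 0 then
    Matrix.GeneralLinearGroup.mkOfDetNeZero !![1, 0; 1, q⁻¹] (by simpa [Matrix.det_fin_two] using h)
  else 1

/-- `β_{a,q} = σ_{1,q}^{-a₁} σ_{2,q}^{a₂} σ_{1,q}^{-a₃} ⋯ σ_{2,q}^{a₂ₙ}` for `a = [a₁, …, a₂ₙ]`. -/
def beta (q : ℝ) : List ℤ → GL (Fin 2) ℝ
  | [] => 1
  | [a] => sigma1 q ^ (-a)
  | a :: b :: l => sigma1 q ^ (-a) * sigma2 q ^ b * beta q l

/-- The point `R / S` of `ℝ ∪ {∞}` given by a vector `(R, S) ≠ 0`, with `R / 0 = ∞`. -/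
def frac (v : Fin 2 → ℝ) : OnePoint ℝ :=
  if v 1 = 0 then ∞ else ((v 0 / v 1 : ℝ) : OnePoint ℝ)

/-- The left `q`-deformed rational `[x]♭ = β_{a,q} (1 / (1 - q))`, where `a` is the even continued
fraction expansion of `x ∈ ℚ ∪ {∞}` (and `1 / (1 - q) = ∞` for `q = 1`). -/
def leftRat (q : ℝ) (x : OnePoint ℚ) : OnePoint ℝ := beta q (evenCF x) • frac ![1, 1 - q]

/-- The right `q`-deformed rational `[x]♯ = β_{a,q} (∞)`, where `a` is the even continued
fraction expansion of `x ∈ ℚ ∪ {∞}`. -/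
def rightRat (q : ℝ) (x : OnePoint ℚ) : OnePoint ℝ := beta q (evenCF x) • (∞ : OnePoint ℝ)

/-- The `q`-deformed irrational numbers: the reals `y = [t]_q`, for `t` irrational, to which
`[r]♯` tends as the rational number `r` tends to `t`. -/
def irrationals (q : ℝ) : Set (OnePoint ℝ) :=
  {p | ∃ (t y : ℝ), Irrational t ∧ p = (y : OnePoint ℝ) ∧
    Tendsto (fun r : ℚ => rightRat q (r : OnePoint ℚ))
      (comap (fun r : ℚ => (r : ℝ)) (𝓝 t)) (𝓝 (y : OnePoint ℝ))}

/-! ### Geodesics and ideal triangles of the upper half plane -/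

/-- Homogeneous coordinates of a point of `ℝ ∪ {∞}`. -/
def hcoord : OnePoint ℝ → Fin 2 → ℝ
  | ∞ => ![1, 0]
  | (x : ℝ) => ![x, 1]

/-- The real part of `(z - x) * conj (z - y)`, that is `|z - (x + y) / 2|² - ((x - y) / 2)²`, for
real `x` and `y`; for `y = ∞` it is `x - re z`. -/
def sideForm (x y : OnePoint ℝ) (z : ℂ) : ℝ :=
  ((z * hcoord x 1 - hcoord x 0) * (starRingEnd ℂ) (z * hcoord y 1 - hcoord y 0)).re

/-- The determinant of the homogeneous coordinates of two points of `ℝ ∪ {∞}`. -/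
def pdet (x y : OnePoint ℝ) : ℝ := hcoord x 0 * hcoord y 1 - hcoord x 1 * hcoord y 0

/-- The complete hyperbolic geodesic with ideal endpoints `x` and `y`: the half circle with
diameter `[x, y]`, or the vertical half line through `x` if `y = ∞`. It is empty if `x = y`. -/
def geodesic (x y : OnePoint ℝ) : Set ℍ := {z | sideForm x y z = 0}

/-- The closed half plane bounded by the geodesic with endpoints `x` and `y` and having the point
`w` of `ℝ ∪ {∞}` on its ideal boundary (for `x`, `y`, `w` distinct). For real points,
`pdet x w * pdet y w = (w - x) * (w - y)` is the value of `sideForm x y` at `w`. -/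
def halfPlane (x y w : OnePoint ℝ) : Set ℍ :=
  {z | 0 ≤ sideForm x y z * (pdet x w * pdet y w)}

/-- The closed ideal triangle (with its sides, without its ideal vertices) with distinct vertices
`x`, `y`, `w` in `ℝ ∪ {∞}`. -/
def idealTriangle (x y w : OnePoint ℝ) : Set ℍ :=
  halfPlane x y w ∩ halfPlane y w x ∩ halfPlane w x y

/-! ### The deformed Farey tessellation -/

/-- `IsEdge q u v j`: the `q`-deformed Farey tessellation has an edge with left vertex the fraction
`u = R / S`, right vertex the fraction `v = R' / S'`, and label `q ^ j`. We start from the edge from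
`0 / 1` to `1 / 0` (positive half) and from the same edge seen as going from `-1 / 0` to `0 / q`
(negative half), both with label `q⁻¹`. Below an edge with label `q ^ (k - 1)` we add the vertex
`(R + q ^ k R') / (S + q ^ k S')`, an edge with label `1` to its left and an edge with
label `q ^ k` to its right. -/
inductive IsEdge (q : ℝ) : (Fin 2 → ℝ) → (Fin 2 → ℝ) → ℤ → Prop
  | pos : IsEdge q ![0, 1] ![1, 0] (-1)
  | neg : IsEdge q ![-1, 0] ![0, q] (-1)
  | left {u v : Fin 2 → ℝ} {j : ℤ} (h : IsEdge q u v j) :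
      IsEdge q u (u + q ^ (j + 1) • v) 0
  | right {u v : Fin 2 → ℝ} {j : ℤ} (h : IsEdge q u v j) :
      IsEdge q (u + q ^ (j + 1) • v) v (j + 1)

/-- The subset `L_q` of the upper half plane covered by the triangles of the `q`-deformed Farey
tessellation. -/
def region (q : ℝ) : Set ℍ :=
  {z | ∃ (u v : Fin 2 → ℝ) (j : ℤ), IsEdge q u v j ∧
    z ∈ idealTriangle (frac u) (frac (u + q ^ (j + 1) • v)) (frac v)}

/-! ### Everything inside the Riemann sphere `ℂ ∪ {∞}` -/

/-- The inclusion of the upper half plane in `ℂ ∪ {∞}`. -/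
def planeIncl (z : ℍ) : OnePoint ℂ := ((z : ℂ) : OnePoint ℂ)

/-- The inclusion of `ℝ ∪ {∞}` in `ℂ ∪ {∞}`. -/
def circleIncl (x : OnePoint ℝ) : OnePoint ℂ := OnePoint.map (fun t : ℝ => (t : ℂ)) x

/-- `L_q` as a subset of the Riemann sphere. -/
def sphereRegion (q : ℝ) : Set (OnePoint ℂ) := planeIncl '' region q

/-- The `q`-deformed rational curve of `x ∈ ℚ ∪ {∞}`: the geodesic from `[x]♭` to `[x]♯`, together
with its endpoints. -/
def ratCurve (q : ℝ) (x : OnePoint ℚ) : Set (OnePoint ℂ) :=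
  planeIncl '' geodesic (leftRat q x) (rightRat q x) ∪
    circleIncl '' {leftRat q x, rightRat q x}

/-- `ℚ_q`: the union of all `q`-deformed rational curves together with their endpoints. -/
def rationalPart (q : ℝ) : Set (OnePoint ℂ) := ⋃ x : OnePoint ℚ, ratCurve q x

/-- `𝕀_q`: the set of `q`-deformed irrational numbers, as a subset of the Riemann sphere. -/
def irrationalPart (q : ℝ) : Set (OnePoint ℂ) := circleIncl '' irrationals q

end QFarey

end

/-! The closed upper half plane is transported to the Klein disc. There geodesics are chords, and a
half plane is an affine inequality in `qf u v`. On the unit circle this affine function factors into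
two determinants (`qf_dir`), so every question of position becomes a question about signs of `dt`.

An edge is stored as (u, w), where w is the right vertex already multiplied by its power of q. It is
addressed by a word of right moves (u + w, q w) and left moves (u, q (u + w)). Right moves preserve
`flat` = (1 - q) u + w. Hence for q < 1 the edges met along an endless run of right moves do not
shrink to w: they converge to the chord from `flat` to w. This chord is a rational curve, and beyond
it lies a gap that no triangle enters. Along a path with infinitely many left moves the edges do
shrink to a point (`tendsto_invWidth`).

Let K be the closed disc with all open gaps removed (`kleinHull`); it is closed and convex. Neither
a vertex nor a `flat` point lies in a gap (`gap_avoid`), so K contains the triangles and the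
rational chords. Conversely, a point of K in no triangle lies beyond all edges of some infinite
path. A path that is eventually right puts it on a rational chord, one that is eventually left puts
it at a vertex, and any other path ends at one point of the circle, an irrational point
(`kleinHull_subset`). The region is open because each edge has a triangle on either side, and the
rational chords support K. So the region is the interior of K, and the rational and irrational parts
form its frontier. Rescaling by gauges carries the convex body K onto the disc; this gives the open
disk and the circle, and it fixes the frontier points that already lie on the unit circle.

The link with the definitions is that addresses do not depend on q. The even continued fraction of x
spells a word (`exists_word`), and every word comes from some x (`exists_rat_curve`). For irrational
t, the rationals near t have addresses extending the prefixes of the path of t at q = 1, so the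
deformed rationals converge to the end of the same path for every q (`mem_irrationals`). -/

noncomputable section

namespace QFarey

/-! ### Plane vectors, quadratic forms and the Klein model -/

/-- The determinant of two plane vectors, positive when the slope coordinate increases. -/
def dt (u v : Fin 2 → ℝ) : ℝ := u 1 * v 0 - u 0 * v 1

/-- The squared Euclidean length of a plane vector. -/
def len2 (v : Fin 2 → ℝ) : ℝ := v 0 ^ 2 + v 1 ^ 2

/-- The affine function on the Klein disc vanishing on the chord between the directions of `u`
and `v`. -/
def qf (u v : Fin 2 → ℝ) (ξ : ℂ) : ℝ :=
  u 1 * v 1 * (1 + ξ.re) - (u 0 * v 1 + u 1 * v 0) * ξ.im + u 0 * v 0 * (1 - ξ.re)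

/-- The point of the unit circle corresponding to the direction of a plane vector. -/
def dir (v : Fin 2 → ℝ) : ℂ := ⟨(v 0 ^ 2 - v 1 ^ 2) / len2 v, 2 * v 0 * v 1 / len2 v⟩

theorem len2_pos {v : Fin 2 → ℝ} (hv : v ≠ 0) : 0 < len2 v := by
  unfold len2
  by_contra h
  apply hv
  have h0 : v 0 = 0 := by nlinarith [sq_nonneg (v 0), sq_nonneg (v 1)]
  have h1 : v 1 = 0 := by nlinarith [sq_nonneg (v 0), sq_nonneg (v 1)]
  ext i; fin_cases i <;> simp [h0, h1]

theorem dt_self (u : Fin 2 → ℝ) : dt u u = 0 := by unfold dt; ring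

theorem dt_swap (u v : Fin 2 → ℝ) : dt u v = - dt v u := by unfold dt; ring

theorem dt_add_left (u v x : Fin 2 → ℝ) : dt (u + v) x = dt u x + dt v x := by
  simp only [dt, Pi.add_apply]; ring

theorem dt_add_right (x u v : Fin 2 → ℝ) : dt x (u + v) = dt x u + dt x v := by
  simp only [dt, Pi.add_apply]; ring

theorem dt_smul_left (c : ℝ) (u x : Fin 2 → ℝ) : dt (c • u) x = c * dt u x := by
  simp only [dt, Pi.smul_apply, smul_eq_mul]; ring

theorem dt_smul_right (c : ℝ) (x u : Fin 2 → ℝ) : dt x (c • u) = c * dt x u := by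
  simp only [dt, Pi.smul_apply, smul_eq_mul]; ring

theorem ne_zero_of_dt_left {u v : Fin 2 → ℝ} (h : dt u v ≠ 0) : u ≠ 0 := by
  rintro rfl; simp [dt] at h

theorem ne_zero_of_dt_right {u v : Fin 2 → ℝ} (h : dt u v ≠ 0) : v ≠ 0 := by
  rintro rfl; simp [dt] at h

theorem exists_smul_of_dt_eq_zero {u x : Fin 2 → ℝ} (hu : u ≠ 0) (hx : x ≠ 0)
    (h : dt u x = 0) : ∃ c : ℝ, c ≠ 0 ∧ x = c • u := by
  have hl := len2_pos hu
  have key : x = ((u 0 * x 0 + u 1 * x 1) / len2 u) • u := by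
    unfold dt at h
    unfold len2 at hl ⊢
    ext i; fin_cases i
    · simp only [Fin.zero_eta, Pi.smul_apply, smul_eq_mul]
      field_simp
      linear_combination u 1 * h
    · simp only [Fin.mk_one, Pi.smul_apply, smul_eq_mul]
      field_simp
      linear_combination - u 0 * h
  refine ⟨_, ?_, key⟩
  intro h0
  rw [h0, zero_smul] at key
  exact hx key

/-! ### Chord functions on the disc -/

theorem qf_comm (u v : Fin 2 → ℝ) (ξ : ℂ) : qf u v ξ = qf v u ξ := by unfold qf; ring

theorem qf_add_left (u v x : Fin 2 → ℝ) (ξ : ℂ) : qf (u + v) x ξ = qf u x ξ + qf v x ξ := by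
  simp only [qf, Pi.add_apply]; ring

theorem qf_add_right (x u v : Fin 2 → ℝ) (ξ : ℂ) : qf x (u + v) ξ = qf x u ξ + qf x v ξ := by
  simp only [qf, Pi.add_apply]; ring

theorem qf_smul_left (c : ℝ) (u x : Fin 2 → ℝ) (ξ : ℂ) : qf (c • u) x ξ = c * qf u x ξ := by
  simp only [qf, Pi.smul_apply, smul_eq_mul]; ring

theorem qf_smul_right (c : ℝ) (x u : Fin 2 → ℝ) (ξ : ℂ) : qf x (c • u) ξ = c * qf x u ξ := by
  simp only [qf, Pi.smul_apply, smul_eq_mul]; ring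

theorem continuous_qf (u v : Fin 2 → ℝ) : Continuous (qf u v) := by
  unfold qf; fun_prop

/-- The affine function vanishes on the circle exactly at the two ends of its chord, each end
contributing one linear factor. Points of the arc from u to v get a negative sign. -/
theorem qf_dir (u v : Fin 2 → ℝ) {p : Fin 2 → ℝ} (hp : p ≠ 0) :
    qf u v (dir p) = 2 * (dt u p * dt v p) / len2 p := by
  have := (len2_pos hp).ne'
  unfold qf dir dt
  field_simp
  unfold len2
  ring

theorem qf_dir_nonpos {u v p : Fin 2 → ℝ} (hp : p ≠ 0) :
    qf u v (dir p) ≤ 0 ↔ dt u p * dt v p ≤ 0 := by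
  rw [qf_dir u v hp, div_le_iff₀ (len2_pos hp)]
  constructor <;> intro h <;> linarith

theorem qf_dir_nonneg {u v p : Fin 2 → ℝ} (hp : p ≠ 0) :
    0 ≤ qf u v (dir p) ↔ 0 ≤ dt u p * dt v p := by
  rw [qf_dir u v hp, le_div_iff₀ (len2_pos hp)]
  constructor <;> intro h <;> linarith

theorem qf_dir_neg {u v p : Fin 2 → ℝ} (hp : p ≠ 0) :
    qf u v (dir p) < 0 ↔ dt u p * dt v p < 0 := by
  rw [← not_le, ← not_le, qf_dir_nonneg hp]

theorem qf_dir_eq_zero {u v p : Fin 2 → ℝ} (hp : p ≠ 0) :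
    qf u v (dir p) = 0 ↔ dt u p * dt v p = 0 := by
  rw [le_antisymm_iff, qf_dir_nonneg hp, qf_dir_nonpos hp, ← le_antisymm_iff]

theorem norm_le_one_iff (ξ : ℂ) : ‖ξ‖ ≤ 1 ↔ ξ.re ^ 2 + ξ.im ^ 2 ≤ 1 := by
  rw [← sq_le_one_iff₀ (norm_nonneg ξ), Complex.sq_norm, Complex.normSq_apply, sq, sq]

theorem norm_lt_one_iff (ξ : ℂ) : ‖ξ‖ < 1 ↔ ξ.re ^ 2 + ξ.im ^ 2 < 1 := by
  rw [← sq_lt_one_iff₀ (norm_nonneg ξ), Complex.sq_norm, Complex.normSq_apply, sq, sq]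

theorem norm_dir {v : Fin 2 → ℝ} (hv : v ≠ 0) : ‖dir v‖ = 1 := by
  have h := (len2_pos hv).ne'
  rw [← sq_eq_sq₀ (norm_nonneg _) zero_le_one, Complex.sq_norm, Complex.normSq_apply]
  unfold dir
  field_simp
  unfold len2
  ring

theorem dir_smul {c : ℝ} (hc : c ≠ 0) (v : Fin 2 → ℝ) : dir (c • v) = dir v := by
  have : len2 (c • v) = c ^ 2 * len2 v := by
    simp only [len2, Pi.smul_apply, smul_eq_mul]; ring
  unfold dir
  rw [this]
  simp only [Pi.smul_apply, smul_eq_mul]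
  congr 1
  · rw [← mul_div_mul_left (v 0 ^ 2 - v 1 ^ 2) (len2 v) (pow_ne_zero 2 hc)]; ring
  · rw [← mul_div_mul_left (2 * v 0 * v 1) (len2 v) (pow_ne_zero 2 hc)]; ring

/-- For equal arguments the chord degenerates to the tangent line at `dir u`, which has the disc on
one side. -/
theorem qf_self_nonneg (u : Fin 2 → ℝ) {ξ : ℂ} (h : ‖ξ‖ ≤ 1) : 0 ≤ qf u u ξ := by
  rw [norm_le_one_iff] at h
  have h1 : ξ.re ≤ 1 := by nlinarith [sq_nonneg ξ.im]
  have h2 : -1 ≤ ξ.re := by nlinarith [sq_nonneg ξ.im]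
  unfold qf
  rcases h1.lt_or_eq with h1 | h1
  -- Multiplied by 1 - re ξ, the form is (u₀ (1 - re ξ) - u₁ im ξ)² + u₁² (1 - |ξ|²).
  · have : 0 ≤ (1 - ξ.re) * (u 1 * u 1 * (1 + ξ.re) - (u 0 * u 1 + u 1 * u 0) * ξ.im +
        u 0 * u 0 * (1 - ξ.re)) := by
      nlinarith [sq_nonneg (u 0 * (1 - ξ.re) - u 1 * ξ.im), mul_nonneg (sq_nonneg (u 1))
        (sub_nonneg.2 h)]
    exact nonneg_of_mul_nonneg_right this (by linarith)
  · have h0 : ξ.im = 0 := by rw [h1] at h; nlinarith [sq_nonneg ξ.im]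
    rw [h1, h0]; nlinarith [sq_nonneg (u 1)]

theorem qf_self_pos {u : Fin 2 → ℝ} (hu : u ≠ 0) {ξ : ℂ} (h : ‖ξ‖ < 1) : 0 < qf u u ξ := by
  rw [norm_lt_one_iff] at h
  have h1 : ξ.re < 1 := by nlinarith [sq_nonneg ξ.im]
  have hl := len2_pos hu
  unfold qf
  unfold len2 at hl
  have : 0 < (1 - ξ.re) * (u 1 * u 1 * (1 + ξ.re) - (u 0 * u 1 + u 1 * u 0) * ξ.im +
      u 0 * u 0 * (1 - ξ.re)) := by
    by_cases h0 : u 1 = 0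
    · rw [h0] at hl ⊢
      have : 0 < (u 0 * (1 - ξ.re)) ^ 2 := by
        have : u 0 ≠ 0 := by rintro h; rw [h] at hl; norm_num at hl
        have : u 0 * (1 - ξ.re) ≠ 0 := mul_ne_zero this (by linarith)
        positivity
      nlinarith
    · have : 0 < u 1 ^ 2 := by positivity
      nlinarith [sq_nonneg (u 0 * (1 - ξ.re) - u 1 * ξ.im), mul_pos this
        (sub_pos.2 h)]
  exact pos_of_mul_pos_right this (by linarith)

/-- A form is determined by its values at the vertices of a triangle `u`, `u + w`, `w`. -/
theorem qf_mul_dt_sq (a b u w : Fin 2 → ℝ) (ξ : ℂ) :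
    qf a b ξ * dt u w ^ 2 = qf w (u + w) ξ * (dt a u * dt b u) +
      qf u (u + w) ξ * (dt a w * dt b w) +
      (- qf u w ξ) * (dt a (u + w) * dt b (u + w)) := by
  simp only [qf, dt, Pi.add_apply]; ring

/-- The cap cut off by a chord is contained in a small disc around an end point. -/
theorem dist_dir_sq_le {u w : Fin 2 → ℝ} (hu : u ≠ 0) (hw : w ≠ 0) {ξ : ℂ} (hξ : ‖ξ‖ ≤ 1)
    (h : qf u w ξ ≤ 0) (huw : 0 ≤ u 0 * w 0 + u 1 * w 1) :
    ‖ξ - dir w‖ ^ 2 ≤ 4 * (dt u w ^ 2 / (len2 u * len2 w)) := by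
  have hl := len2_pos hu
  have hk := len2_pos hw
  have h1 : len2 u * qf w w ξ ≤ 2 * dt u w ^ 2 := by
    -- With `qf u w ξ ≤ 0` and an acute angle between u and w, all three terms on the left are
    -- nonnegative, so the first alone is at most the right side.
    have e : len2 u * qf w w ξ + len2 w * qf u u ξ - 2 * (u 0 * w 0 + u 1 * w 1) * qf u w ξ
        = 2 * dt u w ^ 2 := by
      simp only [len2, qf, dt]; ring
    nlinarith [mul_nonneg hk.le (qf_self_nonneg u hξ), mul_nonneg huw (neg_nonneg.2 h)]
  have h2 : ‖ξ - dir w‖ ^ 2 ≤ 2 * (qf w w ξ / len2 w) := by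
    rw [norm_le_one_iff] at hξ
    rw [Complex.sq_norm, Complex.normSq_apply, Complex.sub_re, Complex.sub_im]
    have e : (dir w).re ^ 2 + (dir w).im ^ 2 = 1 := by
      have := norm_dir hw
      rw [← sq_eq_sq₀ (norm_nonneg _) zero_le_one, Complex.sq_norm, Complex.normSq_apply] at this
      linarith
    -- The tangent function is one minus the inner product with the point of contact, which controls
    -- the squared distance because ξ is in the unit disc.
    have e2 : qf w w ξ / len2 w = 1 - (ξ.re * (dir w).re + ξ.im * (dir w).im) := by
      unfold qf dir
      field_simp
      unfold len2
      ring
    rw [e2]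
    nlinarith
  have h3 : qf w w ξ / len2 w ≤ 2 * (dt u w ^ 2 / (len2 u * len2 w)) := by
    rw [← mul_div_assoc, div_le_div_iff₀ hk (by positivity)]
    nlinarith
  linarith

theorem qf_line (u v : Fin 2 → ℝ) (ξ η : ℂ) (a b : ℝ) (hab : a + b = 1) :
    qf u v (a • ξ + b • η) = a * qf u v ξ + b * qf u v η := by
  obtain rfl : a = 1 - b := by linarith
  simp only [qf, Complex.add_re, Complex.add_im, Complex.real_smul, Complex.mul_re,
    Complex.mul_im, Complex.ofReal_re, Complex.ofReal_im]
  ring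

/-! ### Edges of the tessellation indexed by words -/

/-- An edge with left vertex `u`, right vertex `v` and label `q ^ (k - 1)`, stored as
`(u, q ^ k v)`. -/
abbrev State := (Fin 2 → ℝ) × (Fin 2 → ℝ)

/-- The right (`true`) or left (`false`) edge below a given one. -/
def step (q : ℝ) (d : Bool) (s : State) : State :=
  if d then (s.1 + s.2, q • s.2) else (s.1, q • (s.1 + s.2))

theorem step_true (q : ℝ) (s : State) : step q true s = (s.1 + s.2, q • s.2) := rfl

theorem step_false (q : ℝ) (s : State) : step q false s = (s.1, q • (s.1 + s.2)) := rfl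

/-- The edge reached from `s` by following a word. -/
def run (q : ℝ) : List Bool → State → State
  | [], s => s
  | d :: l, s => run q l (step q d s)

theorem run_append (q : ℝ) (l m : List Bool) (s : State) :
    run q (l ++ m) s = run q m (run q l s) := by
  induction l generalizing s with
  | nil => rfl
  | cons d l ih => exact ih _

/-- The initial edge of the positive (`true`) and of the negative (`false`) half. -/
def root (q : ℝ) (b : Bool) : State := if b then (![0, 1], ![1, 0]) else (![-1, 0], ![0, q])

theorem root_true (q : ℝ) : root q true = (![0, 1], ![1, 0]) := rfl

theorem root_false (q : ℝ) : root q false = (![-1, 0], ![0, q]) := rfl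

/-- The edge with a given address. -/
def edge (q : ℝ) (b : Bool) (l : List Bool) : State := run q l (root q b)

theorem edge_nil (q : ℝ) (b : Bool) : edge q b [] = root q b := rfl

theorem edge_append (q : ℝ) (b : Bool) (l m : List Bool) :
    edge q b (l ++ m) = run q m (edge q b l) := run_append q l m _

theorem edge_snoc (q : ℝ) (b : Bool) (l : List Bool) (d : Bool) :
    edge q b (l ++ [d]) = step q d (edge q b l) := edge_append q b l [d]

/-- The limit of the left vertices of the edges to the right below a given one. -/
def flat (q : ℝ) (s : State) : Fin 2 → ℝ := (1 - q) • s.1 + s.2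

/-- This is the identity (1 - q)(u + w) + q w = (1 - q) u + w. The invariance makes `flat` the
obstacle that endless right moves cannot pass. -/
theorem flat_step_true (q : ℝ) (s : State) : flat q (step q true s) = flat q s := by
  simp only [flat, step_true]; module

theorem flat_run_true (q : ℝ) (k : ℕ) (s : State) :
    flat q (run q (List.replicate k true) s) = flat q s := by
  induction k generalizing s with
  | zero => rfl
  | succ k ih => rw [List.replicate_succ, run, ih, flat_step_true]

theorem snd_run_true (q : ℝ) (k : ℕ) (s : State) :
    (run q (List.replicate k true) s).2 = q ^ k • s.2 := by
  induction k generalizing s with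
  | zero => simp [run]
  | succ k ih => rw [List.replicate_succ, run, ih, step_true, smul_smul, pow_succ]

theorem dt_step (q : ℝ) (d : Bool) (s : State) :
    dt (step q d s).1 (step q d s).2 = q * dt s.1 s.2 := by
  cases d
  · simp only [step_false, dt_smul_right, dt_add_right, dt_self, zero_add]
  · simp only [step_true, dt_smul_right, dt_add_left, dt_self, add_zero]

theorem dt_run (q : ℝ) (l : List Bool) (s : State) :
    dt (run q l s).1 (run q l s).2 = q ^ l.length * dt s.1 s.2 := by
  induction l generalizing s with
  | nil => simp [run]
  | cons d l ih => rw [run, ih, dt_step, List.length_cons, pow_succ]; ring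

theorem dt_root_pos {q : ℝ} (hq : 0 < q) (b : Bool) : 0 < dt (root q b).1 (root q b).2 := by
  cases b <;> simp [root, dt, hq]

theorem dt_edge_pos {q : ℝ} (hq : 0 < q) (b : Bool) (l : List Bool) :
    0 < dt (edge q b l).1 (edge q b l).2 := by
  unfold edge
  rw [dt_run]
  exact mul_pos (pow_pos hq _) (dt_root_pos hq b)

theorem dt_flat_left (q : ℝ) (s : State) (x : Fin 2 → ℝ) :
    dt (flat q s) x = (1 - q) * dt s.1 x + dt s.2 x := by
  rw [flat, dt_add_left, dt_smul_left]

theorem dt_flat_right (q : ℝ) (s : State) (x : Fin 2 → ℝ) :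
    dt x (flat q s) = (1 - q) * dt x s.1 + dt x s.2 := by
  rw [flat, dt_add_right, dt_smul_right]

theorem flat_ne_zero {q : ℝ} {s : State} (h : 0 < dt s.1 s.2) : flat q s ≠ 0 := by
  apply ne_zero_of_dt_right (u := s.1)
  rw [dt_flat_right, dt_self]
  linarith

/-- The closed cone spanned by the vertices of an edge. -/
def InCone (s : State) (x : Fin 2 → ℝ) : Prop := ∃ a b : ℝ, 0 ≤ a ∧ 0 ≤ b ∧ x = a • s.1 + b • s.2

theorem InCone.fst (s : State) : InCone s s.1 := ⟨1, 0, zero_le_one, le_rfl, by simp⟩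

theorem InCone.snd (s : State) : InCone s s.2 := ⟨0, 1, le_rfl, zero_le_one, by simp⟩

theorem InCone.flat {q : ℝ} (hq : q ≤ 1) (s : State) : InCone s (flat q s) :=
  ⟨1 - q, 1, by linarith, zero_le_one, by simp [QFarey.flat]⟩

theorem InCone.of_step {q : ℝ} (hq : 0 < q) {d : Bool} {s : State} {x : Fin 2 → ℝ}
    (h : InCone (step q d s) x) : InCone s x := by
  obtain ⟨a, b, ha, hb, rfl⟩ := h
  cases d
  · exact ⟨a + b * q, b * q, by positivity, by positivity, by simp only [step_false]; module⟩
  · exact ⟨a, a + b * q, by positivity, by positivity, by simp only [step_true]; module⟩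

theorem InCone.of_run {q : ℝ} (hq : 0 < q) {l : List Bool} {s : State} {x : Fin 2 → ℝ}
    (h : InCone (run q l s) x) : InCone s x := by
  induction l generalizing s with
  | nil => exact h
  | cons d l ih => exact InCone.of_step hq (ih h)

theorem InCone.dt_fst {s : State} {x : Fin 2 → ℝ} (h : InCone s x) (hs : 0 < dt s.1 s.2) :
    0 ≤ dt s.1 x := by
  obtain ⟨a, b, ha, hb, rfl⟩ := h
  rw [dt_add_right, dt_smul_right, dt_smul_right, dt_self]
  nlinarith

theorem InCone.dt_snd {s : State} {x : Fin 2 → ℝ} (h : InCone s x) (hs : 0 < dt s.1 s.2) :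
    dt s.2 x ≤ 0 := by
  obtain ⟨a, b, ha, hb, rfl⟩ := h
  rw [dt_add_right, dt_smul_right, dt_smul_right, dt_self, dt_swap]
  nlinarith

/-- Vectors below different children of an edge are separated. -/
theorem dt_nonneg_of_inCone_step {q : ℝ} (hq : 0 < q) {s : State} (hs : 0 < dt s.1 s.2)
    {x y : Fin 2 → ℝ} (hx : InCone (step q false s) x) (hy : InCone (step q true s) y) :
    0 ≤ dt x y := by
  obtain ⟨a, b, ha, hb, rfl⟩ := hx
  obtain ⟨c, e, hc, he, rfl⟩ := hy
  simp only [step_false, step_true, dt_add_right, dt_add_left, dt_smul_left, dt_smul_right,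
    dt_self, dt_swap s.2 s.1]
  have : a * (c * (0 + dt s.1 s.2) + e * (q * dt s.1 s.2)) + b * (q * (c * (0 + dt s.1 s.2) +
      e * (q * dt s.1 s.2) + (c * (-dt s.1 s.2 + 0) + e * (q * 0)))) =
      (a * c + a * e * q + b * q * e * q) * dt s.1 s.2 := by ring
  have h2 : 0 ≤ (a * c + a * e * q + b * q * e * q) * dt s.1 s.2 := by positivity
  nlinarith

/-- The cones of the two children meet only along the mediant, so a vector below one child is on the
same side of both vertices of any edge below the other. -/
theorem dt_mul_dt_nonneg_of_ne {q : ℝ} (hq : 0 < q) {s : State} (hs : 0 < dt s.1 s.2)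
    {d d' : Bool} (hd : d ≠ d') {g h : List Bool} {x : Fin 2 → ℝ}
    (hx : InCone (run q g (step q d' s)) x) :
    0 ≤ dt (run q h (step q d s)).1 x * dt (run q h (step q d s)).2 x := by
  have hx' := InCone.of_run hq hx
  have h1 := InCone.of_run hq (InCone.fst (run q h (step q d s)))
  have h2 := InCone.of_run hq (InCone.snd (run q h (step q d s)))
  cases d <;> cases d' <;> try exact absurd rfl hd
  · exact mul_nonneg (dt_nonneg_of_inCone_step hq hs h1 hx') (dt_nonneg_of_inCone_step hq hs h2 hx')
  · rw [dt_swap, dt_swap _ x, neg_mul_neg]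
    exact mul_nonneg (dt_nonneg_of_inCone_step hq hs hx' h1) (dt_nonneg_of_inCone_step hq hs hx' h2)

/-! ### Addresses determined by position -/

/-- A vector strictly inside the cone of the edge at h lies in the cone of each ancestor of that
edge. Reading both words together, the first differing letter would put the vector and the edge in
separated cones. -/
theorem prefix_of_run {q : ℝ} (hq : 0 < q) (h g : List Bool) {s : State} (hs : 0 < dt s.1 s.2)
    (hlt : dt (run q h s).1 (run q g s).2 * dt (run q h s).2 (run q g s).2 < 0) : h <+: g := by
  induction h generalizing g s with
  | nil => exact List.nil_prefix
  | cons d h ih =>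
    cases g with
    | nil =>
      -- With g exhausted the vector is the right end of the ambient cone, hence not strictly inside
      -- any cone below it.
      exfalso
      obtain ⟨a, b, ha, hb, e1⟩ := InCone.of_run hq (InCone.fst (run q (d :: h) s))
      obtain ⟨c, e, hc, he, e2⟩ := InCone.of_run hq (InCone.snd (run q (d :: h) s))
      rw [e1, e2] at hlt
      simp only [run, dt_add_left, dt_smul_left, dt_self, mul_zero, add_zero] at hlt
      have : 0 ≤ a * dt s.1 s.2 * (c * dt s.1 s.2) := by positivity
      linarith
    | cons d' g =>
      by_cases hd : d = d'
      · subst hd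
        rw [List.cons_prefix_cons]
        exact ⟨rfl, ih g (by rw [dt_step]; positivity) hlt⟩
      · exact absurd hlt (not_lt.2 (dt_mul_dt_nonneg_of_ne hq hs hd (InCone.snd _)))

/-- The vector `flat` belongs to all edges obtained by prolonging g with right moves, so h need only
be a prefix of such a prolongation. -/
theorem prefix_of_run_flat {q : ℝ} (hq : 0 < q) (hq1 : q ≤ 1) (h g : List Bool) {s : State}
    (hs : 0 < dt s.1 s.2) (hlt : dt (run q h s).1 (flat q (run q g s)) *
      dt (run q h s).2 (flat q (run q g s)) < 0) :
    ∃ k, h <+: g ++ List.replicate k true := by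
  induction h generalizing g s with
  | nil => exact ⟨0, List.nil_prefix⟩
  | cons d h ih =>
    have hs' : 0 < dt (step q d s).1 (step q d s).2 := by rw [dt_step]; positivity
    cases g with
    | nil =>
      cases d
      · exfalso
        have h1 := InCone.of_run hq (InCone.fst (run q h (step q false s)))
        have h2 := InCone.of_run hq (InCone.snd (run q h (step q false s)))
        -- The cone of the left child ends at the mediant, which comes before `flat`.
        have key : ∀ x, InCone (step q false s) x → 0 ≤ dt x (flat q s) := by
          rintro x ⟨a, b, ha, hb, rfl⟩
          simp only [step_false, dt_flat_right, dt_add_left, dt_smul_left, dt_self,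
            dt_swap s.2 s.1]
          have : 0 ≤ (a + b * q * q) * dt s.1 s.2 := by positivity
          nlinarith
        simp only [run] at hlt
        linarith [mul_nonneg (key _ h1) (key _ h2)]
      · obtain ⟨k, hk⟩ := ih [] hs' (by simpa only [run, flat_step_true] using hlt)
        exact ⟨k + 1, by simpa [List.replicate_succ] using hk⟩
    | cons d' g =>
      by_cases hd : d = d'
      · subst hd
        obtain ⟨k, hk⟩ := ih g hs' hlt
        exact ⟨k, by rw [List.cons_append, List.cons_prefix_cons]; exact ⟨rfl, hk⟩⟩
      · exact absurd hlt (not_lt.2 (dt_mul_dt_nonneg_of_ne hq hs hd (InCone.flat hq1 _)))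

/-- By induction on the word: passing to the right child only rescales w and keeps `flat`, so the
gap is the same, while the cone of the left child ends before `flat` and misses the gap entirely. -/
theorem gap_avoid {q : ℝ} (hq : 0 < q) (hq1 : q ≤ 1) (g : List Bool) {s : State}
    (hs : 0 < dt s.1 s.2) :
    0 ≤ dt s.2 (run q g s).2 * dt (flat q s) (run q g s).2 ∧
    0 ≤ dt s.2 (flat q (run q g s)) * dt (flat q s) (flat q (run q g s)) := by
  induction g generalizing s with
  | nil => simp [run, dt_self]
  | cons d g ih =>
    have hs' : 0 < dt (step q d s).1 (step q d s).2 := by rw [dt_step]; positivity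
    cases d
    · have key : ∀ x, InCone (step q false s) x → 0 ≤ dt s.2 x * dt (flat q s) x := by
        rintro x ⟨a, b, ha, hb, rfl⟩
        simp only [step_false, dt_flat_left, dt_add_right, dt_smul_right, dt_self,
          dt_swap s.2 s.1]
        have h1 : 0 ≤ (a + b * q) * dt s.1 s.2 := by positivity
        have h2 : 0 ≤ (a + b * q * q) * dt s.1 s.2 := by positivity
        nlinarith [mul_nonneg h1 h2]
      exact ⟨key _ (InCone.of_run hq (InCone.snd _)), key _ (InCone.of_run hq (InCone.flat hq1 _))⟩
    · have := ih hs'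
      rw [flat_step_true] at this
      simp only [step_true, dt_smul_left, mul_assoc] at this
      exact ⟨nonneg_of_mul_nonneg_right this.1 hq, nonneg_of_mul_nonneg_right this.2 hq⟩

/-! ### Comparing edges of the two halves -/

theorem InCone.root_true {q : ℝ} {x : Fin 2 → ℝ} (h : InCone (root q true) x) :
    0 ≤ x 0 ∧ 0 ≤ x 1 := by
  obtain ⟨a, b, ha, hb, rfl⟩ := h
  simp [root, ha, hb]

theorem InCone.root_false {q : ℝ} (hq : 0 < q) {x : Fin 2 → ℝ} (h : InCone (root q false) x) :
    x 0 ≤ 0 ∧ 0 ≤ x 1 := by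
  obtain ⟨a, b, ha, hb, rfl⟩ := h
  simp only [root, Bool.false_eq_true, if_false, Pi.add_apply, Pi.smul_apply, smul_eq_mul,
    Matrix.cons_val_zero, Matrix.cons_val_one]
  constructor
  · linarith
  · simp; positivity

/-- The cones of the two halves are different quadrants, so no vector of one is strictly inside a
cone of the other. -/
theorem root_eq_of_dt_neg {q : ℝ} (hq : 0 < q) {b b' : Bool} {h g : List Bool}
    {x : Fin 2 → ℝ} (hx : InCone (edge q b' g) x)
    (hlt : dt (edge q b h).1 x * dt (edge q b h).2 x < 0) : b = b' := by
  by_contra hb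
  have hx' := InCone.of_run hq hx
  have h1 := InCone.of_run hq (InCone.fst (edge q b h))
  have h2 := InCone.of_run hq (InCone.snd (edge q b h))
  revert hlt
  rw [imp_false, not_lt]
  cases b <;> cases b' <;> try exact absurd rfl hb
  · have a1 := hx'.root_true
    have a2 := h1.root_false hq
    have a3 := h2.root_false hq
    apply mul_nonneg <;> unfold dt <;> nlinarith
  · have a1 := hx'.root_false hq
    have a2 := h1.root_true
    have a3 := h2.root_true
    apply mul_nonneg_of_nonpos_of_nonpos <;> unfold dt <;> nlinarith

theorem prefix_of_edge {q : ℝ} (hq : 0 < q) {b b' : Bool} {h g : List Bool}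
    (hlt : dt (edge q b h).1 (edge q b' g).2 * dt (edge q b h).2 (edge q b' g).2 < 0) :
    b = b' ∧ h <+: g := by
  obtain rfl := root_eq_of_dt_neg hq (InCone.snd _) hlt
  exact ⟨rfl, prefix_of_run hq h g (dt_root_pos hq b) hlt⟩

theorem prefix_of_edge_flat {q : ℝ} (hq : 0 < q) (hq1 : q ≤ 1) {b b' : Bool} {h g : List Bool}
    (hlt : dt (edge q b h).1 (flat q (edge q b' g)) *
      dt (edge q b h).2 (flat q (edge q b' g)) < 0) :
    b = b' ∧ ∃ k, h <+: g ++ List.replicate k true := by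
  obtain rfl := root_eq_of_dt_neg hq (InCone.flat hq1 _) hlt
  exact ⟨rfl, prefix_of_run_flat hq hq1 h g (dt_root_pos hq b) hlt⟩

/-- The arc of the gap from `flat` to w is part of the arc of the edge from u to w. -/
theorem dt_neg_of_gap {q : ℝ} (hq1 : q ≤ 1) {s : State}
    {x : Fin 2 → ℝ} (h : dt s.2 x * dt (flat q s) x < 0) : dt s.1 x * dt s.2 x < 0 := by
  rw [dt_flat_left] at h
  have h1 : (1 - q) * (dt s.1 x * dt s.2 x) < 0 := by nlinarith [sq_nonneg (dt s.2 x)]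
  by_contra h2
  nlinarith [mul_nonneg (sub_nonneg.2 hq1) (not_lt.1 h2)]

/-- No vertex of the tessellation lies in a gap. -/
theorem gap_avoid_snd {q : ℝ} (hq : 0 < q) (hq1 : q ≤ 1) (b b' : Bool) (h g : List Bool) :
    0 ≤ dt (edge q b h).2 (edge q b' g).2 * dt (flat q (edge q b h)) (edge q b' g).2 := by
  by_contra hlt
  rw [not_le] at hlt
  obtain ⟨rfl, m, rfl⟩ := prefix_of_edge hq (dt_neg_of_gap hq1 hlt)
  rw [edge_append] at hlt
  exact absurd (gap_avoid hq hq1 m (dt_edge_pos hq b h)).1 (not_le.2 hlt)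

theorem gap_avoid_flat {q : ℝ} (hq : 0 < q) (hq1 : q ≤ 1) (b b' : Bool) (h g : List Bool) :
    0 ≤ dt (edge q b h).2 (flat q (edge q b' g)) *
      dt (flat q (edge q b h)) (flat q (edge q b' g)) := by
  by_contra hlt
  rw [not_le] at hlt
  obtain ⟨rfl, k, m, hm⟩ := prefix_of_edge_flat hq hq1 (dt_neg_of_gap hq1 hlt)
  have e : flat q (edge q b g) = flat q (run q m (edge q b h)) := by
    rw [← edge_append, hm, edge_append, flat_run_true]
  rw [e] at hlt
  exact absurd (gap_avoid hq hq1 m (dt_edge_pos hq b h)).2 (not_le.2 hlt)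

/-- Every left vertex is also a right vertex. -/
theorem fst_edge {q : ℝ} (hq : 0 < q) (b : Bool) (l : List Bool) :
    ∃ (b' : Bool) (g : List Bool) (c : ℝ), c ≠ 0 ∧ (edge q b l).1 = c • (edge q b' g).2 := by
  induction l using List.reverseRecOn with
  | nil =>
    cases b
    · refine ⟨true, [], -1, by norm_num, ?_⟩
      simp [edge_nil, root]
    · refine ⟨false, [], q⁻¹, inv_ne_zero hq.ne', ?_⟩
      simp [edge_nil, root, hq.ne']
  | append_singleton l d ih =>
    cases d
    · rw [edge_snoc, step_false]; exact ih
    · refine ⟨b, l ++ [false], q⁻¹, inv_ne_zero hq.ne', ?_⟩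
      rw [edge_snoc, edge_snoc, step_true, step_false, smul_smul, inv_mul_cancel₀ hq.ne', one_smul]

theorem mid_edge {q : ℝ} (hq : 0 < q) (b : Bool) (l : List Bool) :
    (edge q b l).1 + (edge q b l).2 = q⁻¹ • (edge q b (l ++ [false])).2 := by
  rw [edge_snoc, step_false, smul_smul, inv_mul_cancel₀ hq.ne', one_smul]

/-- The two vertices of an edge form an acute angle. -/
theorem acute_edge {q : ℝ} (hq : 0 < q) (b : Bool) (l : List Bool) :
    0 ≤ (edge q b l).1 0 * (edge q b l).2 0 + (edge q b l).1 1 * (edge q b l).2 1 := by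
  have h1 := InCone.of_run hq (InCone.fst (edge q b l))
  have h2 := InCone.of_run hq (InCone.snd (edge q b l))
  cases b
  · have a1 := h1.root_false hq
    have a2 := h2.root_false hq
    nlinarith
  · have a1 := h1.root_true
    have a2 := h2.root_true
    nlinarith

/-! ### Paths and shrinking of edges -/

/-- The word formed by the first `n` letters of an infinite word. -/
def pre (p : ℕ → Bool) : ℕ → List Bool
  | 0 => []
  | n + 1 => pre p n ++ [p n]

theorem length_pre (p : ℕ → Bool) (n : ℕ) : (pre p n).length = n := by
  induction n with
  | zero => rfl
  | succ n ih => simp [pre, ih]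

theorem pre_getElem? (p : ℕ → Bool) {m n : ℕ} (h : m < n) : (pre p n)[m]? = Option.some (p m) := by
  induction n with
  | zero => omega
  | succ n ih =>
    rw [pre]
    rcases Nat.lt_succ_iff_lt_or_eq.1 h with h | rfl
    · rw [List.getElem?_append_left (by rw [length_pre]; exact h), ih h]
    · rw [List.getElem?_append_right (by rw [length_pre]), length_pre]; simp

theorem exists_path (P : List Bool → Prop) (h0 : P []) (hs : ∀ l, P l → ∃ d, P (l ++ [d])) :
    ∃ p, ∀ n, P (pre p n) := by
  classical
  choose! f hf using hs
  let w : ℕ → List Bool := fun n => Nat.rec [] (fun _ l => l ++ [f l]) n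
  have hw : ∀ n, w (n + 1) = w n ++ [f (w n)] := fun n => rfl
  have hp : ∀ n, pre (fun n => f (w n)) n = w n := by
    intro n
    induction n with
    | zero => rfl
    | succ n ih => rw [pre, ih, hw]
  refine ⟨fun n => f (w n), fun n => ?_⟩
  rw [hp]
  induction n with
  | zero => exact h0
  | succ n ih => rw [hw]; exact hf _ ih

theorem edge_pre_succ (q : ℝ) (b : Bool) (p : ℕ → Bool) (n : ℕ) :
    edge q b (pre p (n + 1)) = step q (p n) (edge q b (pre p n)) := edge_snoc q b _ _

/-- A linear functional positive on the open cone of the root edge. -/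
def height (b : Bool) (v : Fin 2 → ℝ) : ℝ := if b then v 0 + v 1 else v 1 - v 0

theorem height_add (b : Bool) (u v : Fin 2 → ℝ) : height b (u + v) = height b u + height b v := by
  cases b <;> simp [height] <;> ring

theorem height_smul (b : Bool) (c : ℝ) (v : Fin 2 → ℝ) : height b (c • v) = c * height b v := by
  cases b <;> simp [height] <;> ring

theorem height_sq_le (b : Bool) (v : Fin 2 → ℝ) : height b v ^ 2 ≤ 2 * len2 v := by
  cases b <;> simp only [height, len2, if_true, Bool.false_eq_true, if_false] <;>
    nlinarith [sq_nonneg (v 0 + v 1), sq_nonneg (v 0 - v 1)]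

theorem height_edge_pos {q : ℝ} (hq : 0 < q) (b : Bool) (l : List Bool) :
    0 < height b (edge q b l).1 ∧ 0 < height b (edge q b l).2 := by
  induction l using List.reverseRecOn with
  | nil => cases b <;> simp [edge_nil, root, height, hq]
  | append_singleton l d ih =>
    obtain ⟨h1, h2⟩ := ih
    rw [edge_snoc]
    cases d
    · rw [step_false]
      simp only [height_smul, height_add]
      exact ⟨h1, by positivity⟩
    · rw [step_true]
      simp only [height_smul, height_add]
      exact ⟨by positivity, by positivity⟩

/-- The inverse of the width of an edge. -/
def invWidth (q : ℝ) (b : Bool) (l : List Bool) : ℝ :=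
  height b (edge q b l).1 * height b (edge q b l).2 / dt (edge q b l).1 (edge q b l).2

/-- The factor q that the step puts on the right vertex cancels against the factor q gained by the
determinant. -/
theorem invWidth_false {q : ℝ} (hq : 0 < q) (b : Bool) (l : List Bool) :
    invWidth q b (l ++ [false]) = invWidth q b l +
      height b (edge q b l).1 ^ 2 / dt (edge q b l).1 (edge q b l).2 := by
  have := (dt_edge_pos hq b l).ne'
  unfold invWidth
  rw [edge_snoc, dt_step, step_false]
  simp only [height_smul, height_add]
  field_simp
  ring

theorem invWidth_true {q : ℝ} (hq : 0 < q) (b : Bool) (l : List Bool) :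
    invWidth q b (l ++ [true]) = invWidth q b l +
      height b (edge q b l).2 ^ 2 / dt (edge q b l).1 (edge q b l).2 := by
  have := (dt_edge_pos hq b l).ne'
  unfold invWidth
  rw [edge_snoc, dt_step, step_true]
  simp only [height_smul, height_add]
  field_simp

theorem monotone_invWidth {q : ℝ} (hq : 0 < q) (b : Bool) (p : ℕ → Bool) :
    Monotone fun n => invWidth q b (pre p n) := by
  apply monotone_nat_of_le_succ
  intro n
  have := dt_edge_pos hq b (pre p n)
  rw [pre]
  cases p n
  · rw [invWidth_false hq]; linarith [show 0 ≤ height b (edge q b (pre p n)).1 ^ 2 /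
      dt (edge q b (pre p n)).1 (edge q b (pre p n)).2 by positivity]
  · rw [invWidth_true hq]; linarith [show 0 ≤ height b (edge q b (pre p n)).2 ^ 2 /
      dt (edge q b (pre p n)).1 (edge q b (pre p n)).2 by positivity]

theorem height_fst_ge {q : ℝ} (hq : 0 < q) (b : Bool) (l : List Bool) :
    height b (root q b).1 ≤ height b (edge q b l).1 := by
  induction l using List.reverseRecOn with
  | nil => exact le_rfl
  | append_singleton l d ih =>
    rw [edge_snoc]
    cases d
    · rw [step_false]; exact ih
    · rw [step_true, height_add]; linarith [(height_edge_pos hq b l).2]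

theorem dt_edge_le {q : ℝ} (hq : 0 < q) (hq1 : q ≤ 1) (b : Bool) (l : List Bool) :
    dt (edge q b l).1 (edge q b l).2 ≤ dt (root q b).1 (root q b).2 := by
  unfold edge
  rw [dt_run]
  exact mul_le_of_le_one_left (dt_root_pos hq b).le (pow_le_one₀ hq.le hq1)

/-- A left move adds at least c, since the height of the left vertex never decreases and the
determinant never increases. Right moves alone are not enough: for q < 1, a run of them gives
geometrically decaying increments. -/
theorem tendsto_invWidth {q : ℝ} (hq : 0 < q) (hq1 : q ≤ 1) (b : Bool) {p : ℕ → Bool}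
    (hp : ∃ᶠ n in atTop, p n = false) :
    Tendsto (fun n => invWidth q b (pre p n)) atTop atTop := by
  have hmono := monotone_invWidth hq b p
  set c := height b (root q b).1 ^ 2 / dt (root q b).1 (root q b).2 with hc
  have hh : 0 < height b (root q b).1 := (height_edge_pos hq b []).1
  have hd := dt_root_pos hq b
  have hcpos : 0 < c := by positivity
  have key : ∀ N : ℕ, ∃ n, N * c ≤ invWidth q b (pre p n) := by
    intro N
    induction N with
    | zero =>
      refine ⟨0, ?_⟩
      have h1 := height_edge_pos hq b []
      have h2 := dt_edge_pos hq b []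
      have : 0 < invWidth q b [] := div_pos (mul_pos h1.1 h1.2) h2
      simpa [pre] using this.le
    | succ N ih =>
      obtain ⟨n, hn⟩ := ih
      obtain ⟨m, hm, hpm⟩ := (frequently_atTop.1 hp) n
      refine ⟨m + 1, ?_⟩
      have h1 := hmono hm
      rw [pre, hpm, invWidth_false hq]
      have h2 : c ≤ height b (edge q b (pre p m)).1 ^ 2 /
          dt (edge q b (pre p m)).1 (edge q b (pre p m)).2 :=
        div_le_div₀ (by positivity) (pow_le_pow_left₀ hh.le (height_fst_ge hq b _) 2)
          (dt_edge_pos hq b _) (dt_edge_le hq hq1 b _)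
      push_cast
      simp only at h1
      linarith
  refine tendsto_atTop_atTop_of_monotone hmono fun B => ?_
  obtain ⟨N, hN⟩ := exists_nat_ge (B / c)
  obtain ⟨n, hn⟩ := key N
  exact ⟨n, ((div_le_iff₀ hcpos).1 hN).trans hn⟩

/-- Points beyond an edge are close to its end points. -/
theorem norm_sub_dir_le {q : ℝ} (hq : 0 < q) {b : Bool} {l : List Bool} {ξ : ℂ} (hξ : ‖ξ‖ ≤ 1)
    (h : qf (edge q b l).1 (edge q b l).2 ξ ≤ 0) :
    ‖ξ - dir (edge q b l).1‖ ≤ 4 * (invWidth q b l)⁻¹ ∧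
    ‖ξ - dir (edge q b l).2‖ ≤ 4 * (invWidth q b l)⁻¹ := by
  have hd := dt_edge_pos hq b l
  obtain ⟨h1, h2⟩ := height_edge_pos hq b l
  have hu := ne_zero_of_dt_left hd.ne'
  have hw := ne_zero_of_dt_right hd.ne'
  have k1 := height_sq_le b (edge q b l).1
  have k2 := height_sq_le b (edge q b l).2
  have hI : 0 < invWidth q b l := div_pos (mul_pos h1 h2) hd
  -- The two factors 2 in `height_sq_le` give the 4 here; the 4 of `dist_dir_sq_le` makes it 16, the
  -- square of the constant in the statement.
  have key : dt (edge q b l).1 (edge q b l).2 ^ 2 / (len2 (edge q b l).1 * len2 (edge q b l).2) ≤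
      4 * ((invWidth q b l)⁻¹) ^ 2 := by
    unfold invWidth
    rw [inv_div, div_pow, ← mul_div_assoc, div_le_div_iff₀
      (mul_pos (len2_pos hu) (len2_pos hw)) (by positivity), mul_pow]
    have := mul_le_mul k1 k2 (by positivity) (by linarith [len2_pos hu])
    nlinarith [sq_nonneg (dt (edge q b l).1 (edge q b l).2)]
  constructor
  · refine le_of_sq_le_sq ?_ (by positivity)
    have := dist_dir_sq_le hw hu hξ (by rw [qf_comm]; exact h)
      (by have := acute_edge hq b l; linarith)
    rw [dt_swap, neg_sq, mul_comm (len2 _)] at this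
    nlinarith
  · refine le_of_sq_le_sq ?_ (by positivity)
    have := dist_dir_sq_le hu hw hξ h (acute_edge hq b l)
    nlinarith

theorem exists_small {q : ℝ} (hq : 0 < q) (hq1 : q ≤ 1) (b : Bool) {p : ℕ → Bool}
    (hp : ∃ᶠ n in atTop, p n = false) {ε : ℝ} (hε : 0 < ε) :
    ∀ᶠ n in atTop, 4 * (invWidth q b (pre p n))⁻¹ < ε := by
  have h := ((tendsto_invWidth hq hq1 b hp).inv_tendsto_atTop).const_mul 4
  rw [mul_zero] at h
  exact h.eventually (gt_mem_nhds hε)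

/-! ### The tessellated part of the Klein disc -/

/-- The triangle below an edge. -/
def Tri (s : State) (ξ : ℂ) : Prop :=
  qf s.1 s.2 ξ ≤ 0 ∧ 0 ≤ qf s.1 (s.1 + s.2) ξ ∧ 0 ≤ qf s.2 (s.1 + s.2) ξ

/-- The union of the triangles in the Klein disc. -/
def kleinRegion (q : ℝ) : Set ℂ := {ξ | ‖ξ‖ < 1 ∧ ∃ b l, Tri (edge q b l) ξ}

/-- The complement of the open gaps in the closed Klein disc. -/
def kleinHull (q : ℝ) : Set ℂ :=
  {ξ | ‖ξ‖ ≤ 1 ∧ ∀ b l, 0 ≤ qf (edge q b l).2 (flat q (edge q b l)) ξ}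

/-- The rational chords in the Klein disc. -/
def kleinRat (q : ℝ) : Set ℂ :=
  {ξ | ‖ξ‖ ≤ 1 ∧ ∃ b l, qf (edge q b l).2 (flat q (edge q b l)) ξ = 0}

/-- `ξ` lies beyond all edges of a path. -/
def Beyond (q : ℝ) (b : Bool) (p : ℕ → Bool) (ξ : ℂ) : Prop :=
  ‖ξ‖ ≤ 1 ∧ ∀ n, qf (edge q b (pre p n)).1 (edge q b (pre p n)).2 ξ ≤ 0

/-- The path is not eventually constant. -/
def Wild (p : ℕ → Bool) : Prop := (∃ᶠ n in atTop, p n = false) ∧ ∃ᶠ n in atTop, p n = true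

/-- The irrational points in the Klein disc. -/
def kleinIrr (q : ℝ) : Set ℂ := {ξ | ∃ b p, Wild p ∧ Beyond q b p ξ}

/-! ### The convex hull and the open region -/

theorem kleinHull_eq (q : ℝ) : kleinHull q = Metric.closedBall 0 1 ∩
    ⋂ b, ⋂ l, {ξ | 0 ≤ qf (edge q b l).2 (flat q (edge q b l)) ξ} := by
  ext ξ; simp [kleinHull]

theorem isClosed_kleinHull (q : ℝ) : IsClosed (kleinHull q) := by
  rw [kleinHull_eq]
  exact Metric.isClosed_closedBall.inter (isClosed_iInter fun b => isClosed_iInter fun l =>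
    isClosed_le continuous_const (continuous_qf _ _))

/-- Convexity is what the Klein model is used for: removing a gap means intersecting with a half
plane. -/
theorem convex_kleinHull (q : ℝ) : Convex ℝ (kleinHull q) := by
  rw [kleinHull_eq]
  refine (convex_closedBall _ _).inter (convex_iInter fun b => convex_iInter fun l => ?_)
  intro ξ hξ η hη a c ha hc hac
  simp only [mem_ofPred_eq] at hξ hη ⊢
  rw [qf_line _ _ _ _ _ _ hac]
  positivity

theorem dir_snd_mem_kleinHull {q : ℝ} (hq : 0 < q) (hq1 : q ≤ 1) (b : Bool) (l : List Bool) :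
    dir (edge q b l).2 ∈ kleinHull q := by
  have hw := ne_zero_of_dt_right (dt_edge_pos hq b l).ne'
  refine ⟨(norm_dir hw).le, fun b' l' => ?_⟩
  rw [qf_dir_nonneg hw]
  exact gap_avoid_snd hq hq1 _ _ _ _

/-- An affine function that is nonnegative at the three vertices is nonnegative on the triangle, and
vertices avoid gaps. `qf_mul_dt_sq` supplies the barycentric combination. -/
theorem kleinRegion_subset_kleinHull {q : ℝ} (hq : 0 < q) (hq1 : q ≤ 1) :
    kleinRegion q ⊆ kleinHull q := by
  rintro ξ ⟨hξ, b, l, h1, h2, h3⟩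
  refine ⟨hξ.le, fun b' l' => ?_⟩
  have hd := dt_edge_pos hq b l
  have e := qf_mul_dt_sq (edge q b' l').2 (flat q (edge q b' l')) (edge q b l).1 (edge q b l).2 ξ
  refine nonneg_of_mul_nonneg_left ?_ (pow_pos hd 2)
  rw [e]
  refine add_nonneg (add_nonneg (mul_nonneg h3 ?_) (mul_nonneg h2 (gap_avoid_snd hq hq1 _ _ _ _)))
    (mul_nonneg (neg_nonneg.2 h1) ?_)
  · obtain ⟨b'', g, c, hc, e⟩ := fst_edge hq b l
    rw [e, dt_smul_right, dt_smul_right]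
    have := gap_avoid_snd hq hq1 b' b'' l' g
    nlinarith [mul_nonneg (sq_nonneg c) this]
  · rw [mid_edge hq, dt_smul_right, dt_smul_right]
    have := gap_avoid_snd hq hq1 b' b l' (l ++ [false])
    nlinarith [mul_nonneg (sq_nonneg q⁻¹) this]

theorem isOpen_qf_pos (u v : Fin 2 → ℝ) {ξ : ℂ} (h : 0 < qf u v ξ) : ∀ᶠ η in 𝓝 ξ, 0 < qf u v η :=
  (continuous_qf u v).continuousAt.eventually (lt_mem_nhds h)

/-- Near a point of an edge, the points below the edge lie in the triangle below it. -/
theorem eventually_tri_below {q : ℝ} (hq : 0 < q) (b : Bool) (l : List Bool) {ξ : ℂ}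
    (hξ : ‖ξ‖ < 1) (h : qf (edge q b l).1 (edge q b l).2 ξ = 0) :
    ∀ᶠ η in 𝓝 ξ, qf (edge q b l).1 (edge q b l).2 η ≤ 0 → Tri (edge q b l) η := by
  have hd := dt_edge_pos hq b l
  have hu := qf_self_pos (ne_zero_of_dt_left hd.ne') hξ
  have hw := qf_self_pos (ne_zero_of_dt_right hd.ne') hξ
  filter_upwards [isOpen_qf_pos (edge q b l).1 ((edge q b l).1 + (edge q b l).2) (ξ := ξ)
      (by rw [qf_add_right]; linarith),
    isOpen_qf_pos (edge q b l).2 ((edge q b l).1 + (edge q b l).2) (ξ := ξ)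
      (by rw [qf_add_right, qf_comm (edge q b l).2]; linarith)] with η h1 h2 h3
  exact ⟨h3, h1.le, h2.le⟩

theorem eventually_ball {ξ : ℂ} (hξ : ‖ξ‖ < 1) : ∀ᶠ η in 𝓝 ξ, ‖η‖ < 1 :=
  continuous_norm.continuousAt.eventually (gt_mem_nhds hξ)

/-- Near a point of an edge, the points above the edge lie in the adjacent triangle. -/
theorem eventually_tri_above {q : ℝ} (hq : 0 < q) (b : Bool) (l : List Bool) {ξ : ℂ}
    (hξ : ‖ξ‖ < 1) (h : qf (edge q b l).1 (edge q b l).2 ξ = 0) :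
    ∀ᶠ η in 𝓝 ξ, 0 ≤ qf (edge q b l).1 (edge q b l).2 η → η ∈ kleinRegion q := by
  rcases List.eq_nil_or_concat l with rfl | ⟨l, d, rfl⟩
  -- The root edges of both halves are the same diameter, so the triangle above one root edge is the
  -- one below the other. Every other edge has the triangle of its parent above it.
  · have h' : qf (edge q (!b) []).1 (edge q (!b) []).2 ξ = 0 := by
      cases b
      · simp [edge_nil, root, qf, hq.ne'] at h ⊢; exact h
      · simp [edge_nil, root, qf] at h ⊢; right; exact h
    filter_upwards [eventually_tri_below hq (!b) [] hξ h', eventually_ball hξ] with η h1 h2 h3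
    refine ⟨h2, !b, [], h1 ?_⟩
    cases b
    · simp [edge_nil, root, qf, hq] at h3 ⊢; exact h3
    · simp [edge_nil, root, qf] at h3 ⊢; nlinarith
  · have hd := dt_edge_pos hq b l
    have hu := qf_self_pos (ne_zero_of_dt_left hd.ne') hξ
    have hw := qf_self_pos (ne_zero_of_dt_right hd.ne') hξ
    rw [List.concat_eq_append, edge_snoc] at *
    set s := edge q b l with hs
    have hm : s.1 + s.2 ≠ 0 := by
      apply ne_zero_of_dt_right (u := s.1)
      rw [dt_add_right, dt_self, zero_add]
      exact hd.ne'
    have hm := qf_self_pos hm hξ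
    have e1 := qf_add_right s.1 s.1 s.2 ξ
    have e2 := qf_add_right s.2 s.1 s.2 ξ
    rw [qf_comm s.2 s.1] at e2
    have e3 := qf_add_left s.1 s.2 (s.1 + s.2) ξ
    cases d
    · simp only [step_false, qf_smul_right] at h ⊢
      have h0 : qf s.1 (s.1 + s.2) ξ = 0 := (mul_eq_zero.1 h).resolve_left hq.ne'
      filter_upwards [eventually_ball hξ, isOpen_qf_pos s.2 (s.1 + s.2) (ξ := ξ) (by linarith),
        ((continuous_qf s.1 s.2).continuousAt (x := ξ)).eventually
          (gt_mem_nhds (show _ < 0 by linarith))] with η g1 g2 g3 g4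
      exact ⟨g1, b, l, g3.le, nonneg_of_mul_nonneg_right g4 hq, g2.le⟩
    · simp only [step_true, qf_smul_right] at h ⊢
      rw [qf_comm] at h
      have h0 : qf s.2 (s.1 + s.2) ξ = 0 := (mul_eq_zero.1 h).resolve_left hq.ne'
      filter_upwards [eventually_ball hξ, isOpen_qf_pos s.1 (s.1 + s.2) (ξ := ξ) (by linarith),
        ((continuous_qf s.1 s.2).continuousAt (x := ξ)).eventually
          (gt_mem_nhds (show _ < 0 by linarith))] with η g1 g2 g3 g4
      rw [qf_comm] at g4
      exact ⟨g1, b, l, g3.le, g2.le, nonneg_of_mul_nonneg_right g4 hq⟩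

theorem kleinRegion_mem_nhds_of_edge {q : ℝ} (hq : 0 < q) (b : Bool) (l : List Bool) {ξ : ℂ}
    (hξ : ‖ξ‖ < 1) (h : qf (edge q b l).1 (edge q b l).2 ξ = 0) : kleinRegion q ∈ 𝓝 ξ := by
  filter_upwards [eventually_ball hξ, eventually_tri_below hq b l hξ h,
    eventually_tri_above hq b l hξ h] with η h1 h2 h3
  rcases le_total (qf (edge q b l).1 (edge q b l).2 η) 0 with h4 | h4
  · exact ⟨h1, b, l, h2 h4⟩
  · exact h3 h4

/-- A point of a triangle is inside it or on one of its three sides. Each side is an edge, with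
triangles covering a neighbourhood on both sides. -/
theorem isOpen_kleinRegion {q : ℝ} (hq : 0 < q) : IsOpen (kleinRegion q) := by
  rw [isOpen_iff_mem_nhds]
  rintro ξ ⟨hξ, b, l, h1, h2, h3⟩
  rcases h1.lt_or_eq with h1 | h1
  swap
  · exact kleinRegion_mem_nhds_of_edge hq b l hξ h1
  rcases h2.lt_or_eq with h2 | h2
  swap
  · apply kleinRegion_mem_nhds_of_edge hq b (l ++ [false]) hξ
    rw [edge_snoc, step_false]
    simp only [qf_smul_right, ← h2, mul_zero]
  rcases h3.lt_or_eq with h3 | h3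
  swap
  · apply kleinRegion_mem_nhds_of_edge hq b (l ++ [true]) hξ
    rw [edge_snoc, step_true]
    simp only [qf_smul_right]
    rw [qf_comm, ← h3, mul_zero]
  filter_upwards [eventually_ball hξ, isOpen_qf_pos _ _ h2, isOpen_qf_pos _ _ h3,
    (continuous_qf _ _).continuousAt.eventually (gt_mem_nhds h1)] with η g1 g2 g3 g4
  exact ⟨g1, b, l, g4.le, g2.le, g3.le⟩

/-- Both ends of a rational chord avoid all gaps, so the affine function of any gap is nonnegative
on the chord. -/
theorem kleinRat_subset_kleinHull {q : ℝ} (hq : 0 < q) (hq1 : q ≤ 1) :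
    kleinRat q ⊆ kleinHull q := by
  rintro ξ ⟨hξ, b, l, h⟩
  refine ⟨hξ, fun b' l' => ?_⟩
  have hd := dt_edge_pos hq b l
  have g1 := gap_avoid_snd hq hq1 b' b l' l
  have g2 := gap_avoid_flat hq hq1 b' b l' l
  set s := edge q b l with hs
  set x := (edge q b' l').2
  set y := flat q (edge q b' l')
  have hw0 : s.2 ≠ 0 := ne_zero_of_dt_right hd.ne'
  have hw := qf_self_nonneg s.2 hξ
  have hf := qf_self_nonneg (flat q s) hξ
  rcases hq1.lt_or_eq with hq1 | rfl
  · have hfd : 0 < dt (flat q s) s.2 := by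
      rw [dt_flat_left, dt_self, add_zero]; exact mul_pos (by linarith) hd
    have e := qf_mul_dt_sq x y (flat q s) s.2 ξ
    rw [qf_comm (flat q s) s.2, h, qf_add_right, qf_add_right, qf_comm (flat q s) s.2, h] at e
    refine nonneg_of_mul_nonneg_left ?_ (pow_pos hfd 2)
    rw [e]
    have a1 := mul_nonneg hw g2
    have a2 := mul_nonneg hf g1
    linarith
  -- At q = 1 the chord degenerates to a tangent line, meeting the disc only at the vertex.
  · have hfl : flat 1 s = s.2 := by simp [flat]
    rw [hfl] at h
    have hn : ξ = dir s.2 := by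
      have := dist_dir_sq_le hw0 hw0 hξ h.le (by nlinarith)
      rw [dt_self] at this
      norm_num at this
      exact sub_eq_zero.1 this
    rw [hn, qf_dir_nonneg hw0]
    exact g1

/-! ### Irrational points -/

theorem Beyond.tendsto {q : ℝ} (hq : 0 < q) (hq1 : q ≤ 1) {b : Bool} {p : ℕ → Bool}
    (hp : ∃ᶠ n in atTop, p n = false) {ξ : ℂ} (h : Beyond q b p ξ) :
    Tendsto (fun n => dir (edge q b (pre p n)).2) atTop (𝓝 ξ) ∧
    Tendsto (fun n => dir (edge q b (pre p n)).1) atTop (𝓝 ξ) := by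
  constructor <;> rw [Metric.tendsto_nhds] <;> intro ε hε <;>
    filter_upwards [exists_small hq hq1 b hp hε] with n hn <;>
    rw [dist_comm, dist_eq_norm]
  · exact (norm_sub_dir_le hq h.1 (h.2 n)).2.trans_lt hn
  · exact (norm_sub_dir_le hq h.1 (h.2 n)).1.trans_lt hn

/-- The point is a limit of vertices, and these lie on the unit circle. -/
theorem Beyond.norm_eq_one {q : ℝ} (hq : 0 < q) (hq1 : q ≤ 1) {b : Bool} {p : ℕ → Bool}
    (hp : ∃ᶠ n in atTop, p n = false) {ξ : ℂ} (h : Beyond q b p ξ) : ‖ξ‖ = 1 := by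
  refine tendsto_nhds_unique (h.tendsto hq hq1 hp).1.norm ?_
  refine tendsto_const_nhds.congr fun n => ?_
  exact (norm_dir (ne_zero_of_dt_right (dt_edge_pos hq b _).ne')).symm

theorem kleinIrr_subset_kleinHull {q : ℝ} (hq : 0 < q) (hq1 : q ≤ 1) :
    kleinIrr q ⊆ kleinHull q := by
  rintro ξ ⟨b, p, hp, h⟩
  exact (isClosed_kleinHull q).mem_of_tendsto (h.tendsto hq hq1 hp.1).1
    (Eventually.of_forall fun n => dir_snd_mem_kleinHull hq hq1 _ _)

theorem dir_snd_mem_kleinRat {q : ℝ} (hq : 0 < q) (b : Bool) (l : List Bool) :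
    dir (edge q b l).2 ∈ kleinRat q := by
  have hw := ne_zero_of_dt_right (dt_edge_pos hq b l).ne'
  exact ⟨(norm_dir hw).le, b, l, by rw [qf_dir_eq_zero hw, dt_self, zero_mul]⟩

theorem kleinIrr_subset_closure {q : ℝ} (hq : 0 < q) (hq1 : q ≤ 1) :
    kleinIrr q ⊆ closure (kleinRat q) := by
  rintro ξ ⟨b, p, hp, h⟩
  exact mem_closure_of_tendsto (h.tendsto hq hq1 hp.1).1
    (Eventually.of_forall fun n => dir_snd_mem_kleinRat hq _ _)

theorem exists_dir {ξ : ℂ} (h : ‖ξ‖ = 1) : ∃ v : Fin 2 → ℝ, v ≠ 0 ∧ ξ = dir v := by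
  have h2 : ξ.re ^ 2 + ξ.im ^ 2 = 1 := by
    rw [← sq_eq_sq₀ (norm_nonneg _) zero_le_one, Complex.sq_norm, Complex.normSq_apply] at h
    linarith
  by_cases h0 : 1 + ξ.re = 0
  · refine ⟨![0, 1], fun h => by simpa using congrFun h 1, ?_⟩
    have hre : ξ.re = -1 := by linarith
    have him : ξ.im = 0 := by rw [hre] at h2; nlinarith
    apply Complex.ext <;> simp [dir, len2, hre, him]
  · have hl : len2 ![1 + ξ.re, ξ.im] = 2 * (1 + ξ.re) := by
      simp only [len2, Matrix.cons_val_zero, Matrix.cons_val_one]; linarith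
    -- `dir` doubles angles, and (1 + cos θ, sin θ) has the direction θ / 2.
    refine ⟨![1 + ξ.re, ξ.im], fun h => h0 (by simpa using congrFun h 0), ?_⟩
    apply Complex.ext
    · simp only [dir, hl, Matrix.cons_val_zero, Matrix.cons_val_one]
      field_simp
      linarith
    · simp only [dir, hl, Matrix.cons_val_zero, Matrix.cons_val_one]
      field_simp

theorem dir_eq_of_dt {x y : Fin 2 → ℝ} (hx : x ≠ 0) (hy : y ≠ 0) (h : dt y x = 0) :
    dir x = dir y := by
  obtain ⟨c, hc, rfl⟩ := exists_smul_of_dt_eq_zero hy hx h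
  exact dir_smul hc y

theorem snd_ne_zero {q : ℝ} (hq : 0 < q) (b : Bool) (l : List Bool) : (edge q b l).2 ≠ 0 :=
  ne_zero_of_dt_right (dt_edge_pos hq b l).ne'

theorem fst_ne_zero {q : ℝ} (hq : 0 < q) (b : Bool) (l : List Bool) : (edge q b l).1 ≠ 0 :=
  ne_zero_of_dt_left (dt_edge_pos hq b l).ne'

theorem dir_fst_mem_kleinRat {q : ℝ} (hq : 0 < q) (b : Bool) (l : List Bool) :
    dir (edge q b l).1 ∈ kleinRat q := by
  obtain ⟨b', g, c, hc, e⟩ := fst_edge hq b l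
  rw [e, dir_smul hc]
  exact dir_snd_mem_kleinRat hq _ _

/-- The ideal points of the triangles are their vertices. -/
theorem Tri.mem_kleinRat {q : ℝ} (hq : 0 < q) {b : Bool} {l : List Bool} {ξ : ℂ} (hξ : ‖ξ‖ = 1)
    (h : Tri (edge q b l) ξ) : ξ ∈ kleinRat q := by
  obtain ⟨x, hx, rfl⟩ := exists_dir hξ
  obtain ⟨h1, h2, h3⟩ := h
  rw [qf_dir_nonpos hx] at h1
  rw [qf_dir_nonneg hx, dt_add_left] at h2 h3
  by_cases a1 : dt (edge q b l).1 x = 0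
  · rw [dir_eq_of_dt hx (fst_ne_zero hq b l) a1]
    exact dir_fst_mem_kleinRat hq b l
  by_cases a2 : dt (edge q b l).2 x = 0
  · rw [dir_eq_of_dt hx (snd_ne_zero hq b l) a2]
    exact dir_snd_mem_kleinRat hq b l
  have hlt := lt_of_le_of_ne h1 (mul_ne_zero a1 a2)
  have a3 : dt (edge q b (l ++ [false])).2 x = 0 := by
    rw [edge_snoc, step_false, dt_smul_left, dt_add_left]
    have h4 := mul_nonneg h2 h3
    have h5 : (dt (edge q b l).1 x + dt (edge q b l).2 x) ^ 2 ≤ 0 := by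
      -- The product of the two triangle inequalities is `dt u x * dt w x` times the square of their
      -- sum, and the first factor is negative.
      by_contra hc
      nlinarith [mul_pos_of_neg_of_neg hlt (neg_neg_of_pos (not_le.1 hc))]
    rw [pow_eq_zero_iff two_ne_zero |>.1 (le_antisymm h5 (sq_nonneg _)), mul_zero]
  rw [dir_eq_of_dt hx (snd_ne_zero hq b _) a3]
  exact dir_snd_mem_kleinRat hq b _

/-- A point beyond an edge but outside its triangle is beyond one of the two lower sides, and this
choice repeats forever. -/
theorem exists_beyond {q : ℝ} (hq : 0 < q) {ξ : ℂ} (hξ : ‖ξ‖ ≤ 1)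
    (h : ∀ b l, ¬ Tri (edge q b l) ξ) : ∃ b p, Beyond q b p ξ := by
  have hr : ∃ b, qf (root q b).1 (root q b).2 ξ ≤ 0 := by
    rcases le_total ξ.im 0 with h | h
    · refine ⟨false, ?_⟩
      simp [root, qf]
      nlinarith
    · refine ⟨true, ?_⟩
      simp [root, qf, h]
  obtain ⟨b, hb⟩ := hr
  obtain ⟨p, hp⟩ := exists_path (fun l => qf (edge q b l).1 (edge q b l).2 ξ ≤ 0) hb (by
    intro l hl
    by_contra hc
    push Not at hc
    have h1 := hc false
    have h2 := hc true
    rw [edge_snoc] at h1 h2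
    simp only [step_false, step_true, qf_smul_right] at h1 h2
    rw [qf_comm] at h2
    exact h b l ⟨hl, (pos_of_mul_pos_right h1 hq.le).le, (pos_of_mul_pos_right h2 hq.le).le⟩)
  exact ⟨b, p, hξ, hp⟩

theorem pre_add_of_const {p : ℕ → Bool} {d : Bool} {n : ℕ} (h : ∀ m ≥ n, p m = d) (k : ℕ) :
    pre p (n + k) = pre p n ++ List.replicate k d := by
  induction k with
  | zero => simp
  | succ k ih => rw [← add_assoc, pre, ih, h _ (by omega), List.replicate_succ', List.append_assoc]

theorem fst_run_true_one (k : ℕ) (s : State) :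
    (run 1 (List.replicate k true) s).1 = s.1 + (k : ℝ) • s.2 := by
  induction k generalizing s with
  | zero => simp [run]
  | succ k ih =>
    rw [List.replicate_succ, run, ih, step_true]
    push_cast
    module

theorem smul_fst_run_true (q : ℝ) (k : ℕ) (s : State) :
    (1 - q) • (run q (List.replicate k true) s).1 = flat q s - q ^ k • s.2 := by
  have h1 := flat_run_true q k s
  have h2 := snd_run_true q k s
  rw [flat, h2] at h1
  rw [← h1]; module

/-- Points beyond all edges to the right below an edge lie in the closed gap. -/
theorem qf_flat_nonpos {q : ℝ} (hq : 0 < q) (hq1 : q ≤ 1) {s : State} {ξ : ℂ}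
    (h : ∀ k, qf (run q (List.replicate k true) s).1 (run q (List.replicate k true) s).2 ξ ≤ 0) :
    qf s.2 (flat q s) ξ ≤ 0 := by
  rcases hq1.lt_or_eq with hq1 | rfl
  -- After k right moves 1 - q times the left vertex is `flat - q ^ k w`, so the inequality of the
  -- k-th edge differs from the desired one by a term tending to zero.
  · have key : ∀ k : ℕ, qf s.2 (flat q s) ξ ≤ q ^ k * qf s.2 s.2 ξ := by
      intro k
      have h1 : qf ((1 - q) • (run q (List.replicate k true) s).1)
          (run q (List.replicate k true) s).2 ξ ≤ 0 := by
        rw [qf_smul_left]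
        exact mul_nonpos_of_nonneg_of_nonpos (by linarith) (h k)
      rw [smul_fst_run_true, snd_run_true, qf_smul_right, sub_eq_add_neg, ← neg_smul, qf_add_left,
        qf_smul_left, qf_comm] at h1
      have := nonpos_of_mul_nonpos_right h1 (pow_pos hq k)
      linarith
    have ht := (tendsto_pow_atTop_nhds_zero_of_lt_one hq.le hq1).mul_const (qf s.2 s.2 ξ)
    rw [zero_mul] at ht
    exact ge_of_tendsto' ht key
  · have hfl : flat 1 s = s.2 := by simp [flat]
    rw [hfl]
    by_contra hc
    rw [not_le] at hc
    -- At q = 1 the left vertex after k right moves is u + k w, and a positive `qf w w ξ` would win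
    -- for large k.
    obtain ⟨k, hk⟩ := exists_nat_gt (-qf s.1 s.2 ξ / qf s.2 s.2 ξ)
    rw [div_lt_iff₀ hc] at hk
    have := h k
    rw [fst_run_true_one, snd_run_true, one_pow, one_smul, qf_add_left, qf_smul_left] at this
    linarith

theorem Beyond.mem_of_eventually_true {q : ℝ} (hq : 0 < q) (hq1 : q ≤ 1) {b : Bool}
    {p : ℕ → Bool} {ξ : ℂ} (hB : Beyond q b p ξ) (h : ∀ᶠ n in atTop, p n = true) :
    ∃ l, qf (edge q b l).2 (flat q (edge q b l)) ξ ≤ 0 := by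
  obtain ⟨n, hn⟩ := eventually_atTop.1 h
  refine ⟨pre p n, qf_flat_nonpos hq hq1 fun k => ?_⟩
  rw [← edge_append, ← pre_add_of_const hn]
  exact hB.2 _

/-- Left moves keep the left vertex, so the shrinking edges can only converge to it. -/
theorem Beyond.eq_of_eventually_false {q : ℝ} (hq : 0 < q) (hq1 : q ≤ 1) {b : Bool}
    {p : ℕ → Bool} {ξ : ℂ} (hB : Beyond q b p ξ) (h : ∀ᶠ n in atTop, p n = false) :
    ∃ l, ξ = dir (edge q b l).1 := by
  obtain ⟨n, hn⟩ := eventually_atTop.1 h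
  refine ⟨pre p n, ?_⟩
  refine tendsto_nhds_unique (hB.tendsto hq hq1 h.frequently).2 ?_
  refine tendsto_const_nhds.congr' ?_
  filter_upwards [eventually_ge_atTop n] with m hm
  induction m, hm using Nat.le_induction with
  | base => rfl
  | succ m hm ih => rw [ih, edge_pre_succ, hn m hm, step_false]

/-- Outside the triangles a point has a path, and the tail of the path decides. An eventually right
tail places the point in a closed gap, so on its chord; an eventually left tail makes it a vertex.
-/
theorem kleinHull_subset {q : ℝ} (hq : 0 < q) (hq1 : q ≤ 1) :
    kleinHull q ⊆ kleinRegion q ∪ (kleinRat q ∪ kleinIrr q) := by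
  rintro ξ ⟨hξ, hg⟩
  by_cases ht : ∃ b l, Tri (edge q b l) ξ
  · obtain ⟨b, l, ht⟩ := ht
    rcases hξ.lt_or_eq with hξ | hξ
    · exact Or.inl ⟨hξ, b, l, ht⟩
    · exact Or.inr (Or.inl (ht.mem_kleinRat hq hξ))
  · push Not at ht
    obtain ⟨b, p, hB⟩ := exists_beyond hq hξ ht
    right
    by_cases h1 : ∃ᶠ n in atTop, p n = false
    · by_cases h2 : ∃ᶠ n in atTop, p n = true
      · exact Or.inr ⟨b, p, ⟨h1, h2⟩, hB⟩
      · left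
        obtain ⟨l, rfl⟩ := hB.eq_of_eventually_false hq hq1 (by simpa using h2)
        exact dir_fst_mem_kleinRat hq b l
    · left
      obtain ⟨l, hl⟩ := hB.mem_of_eventually_true hq hq1 (by simpa using h1)
      exact ⟨hξ, b, l, le_antisymm hl (hg b l)⟩

theorem kleinHull_eq_union {q : ℝ} (hq : 0 < q) (hq1 : q ≤ 1) :
    kleinHull q = kleinRegion q ∪ (kleinRat q ∪ kleinIrr q) :=
  (kleinHull_subset hq hq1).antisymm (union_subset (kleinRegion_subset_kleinHull hq hq1)
    (union_subset (kleinRat_subset_kleinHull hq hq1) (kleinIrr_subset_kleinHull hq hq1)))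

/-! ### Interior and frontier of the hull -/

theorem norm_lt_one_of_mem_interior {q : ℝ} {ξ : ℂ} (h : ξ ∈ interior (kleinHull q)) :
    ‖ξ‖ < 1 := by
  have : ξ ∈ interior (Metric.closedBall (0 : ℂ) 1) :=
    interior_mono (fun η hη => by simpa using hη.1) h
  rw [interior_closedBall _ one_ne_zero] at this
  simpa using this

/-- For q < 1 each rational chord supports the hull: from a point on it one can move into the gap at
once. For q = 1 rational points are on the circle, as irrational ones always are. -/
theorem disjoint_interior {q : ℝ} (hq : 0 < q) (hq1 : q ≤ 1) {ξ : ℂ}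
    (h : ξ ∈ interior (kleinHull q)) : ξ ∉ kleinRat q ∪ kleinIrr q := by
  have hn := norm_lt_one_of_mem_interior h
  rintro (⟨-, b, l, h0⟩ | ⟨b, p, hp, hB⟩)
  · have hd := dt_edge_pos hq b l
    rcases hq1.lt_or_eq with hq1 | rfl
    · set s := edge q b l with hs
      have hfd : 0 < dt (flat q s) s.2 := by
        rw [dt_flat_left, dt_self, add_zero]; exact mul_pos (by linarith) hd
      have hx : flat q s + s.2 ≠ 0 := by
        apply ne_zero_of_dt_left (v := s.2)
        rw [dt_add_left, dt_self, add_zero]; exact hfd.ne'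
      -- The direction of `flat + w` is strictly inside the arc of the gap.
      have hlt : qf s.2 (flat q s) (dir (flat q s + s.2)) < 0 := by
        rw [qf_dir_neg hx, dt_add_right, dt_add_right, dt_self, dt_self, dt_swap]
        nlinarith
      set η := dir (flat q s + s.2)
      have hc : Continuous fun t : ℝ => (1 - t) • ξ + t • η := by fun_prop
      have hev : ∀ᶠ t in 𝓝 (0 : ℝ), (1 - t) • ξ + t • η ∈ kleinHull q := by
        apply hc.continuousAt.eventually
        simp only [sub_zero, one_smul, zero_smul, add_zero]
        exact mem_interior_iff_mem_nhds.1 h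
      have hev' : ∀ᶠ t in 𝓝[>] (0 : ℝ), (1 - t) • ξ + t • η ∈ kleinHull q :=
        hev.filter_mono nhdsWithin_le_nhds
      obtain ⟨t, ht, ht0⟩ := (hev'.and self_mem_nhdsWithin).exists
      have := ht.2 b l
      rw [← hs, qf_line _ _ _ _ _ _ (by ring), h0] at this
      have := mul_neg_of_pos_of_neg (mem_Ioi.1 ht0) hlt
      linarith
    · have hfl : flat 1 (edge 1 b l) = (edge 1 b l).2 := by simp [flat]
      rw [hfl] at h0
      exact (qf_self_pos (snd_ne_zero hq b l) hn).ne' h0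
  · exact hn.ne (hB.norm_eq_one hq hq1 hp.1)

theorem interior_kleinHull {q : ℝ} (hq : 0 < q) (hq1 : q ≤ 1) :
    interior (kleinHull q) = kleinRegion q := by
  apply Subset.antisymm
  · intro ξ h
    have := interior_subset h
    rw [kleinHull_eq_union hq hq1] at this
    exact this.resolve_right (disjoint_interior hq hq1 h)
  · exact interior_maximal (kleinRegion_subset_kleinHull hq hq1) (isOpen_kleinRegion hq)

theorem frontier_kleinHull {q : ℝ} (hq : 0 < q) (hq1 : q ≤ 1) :
    frontier (kleinHull q) = kleinRat q ∪ kleinIrr q := by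
  rw [(isClosed_kleinHull q).frontier_eq]
  apply Subset.antisymm
  · rintro ξ ⟨h1, h2⟩
    rw [interior_kleinHull hq hq1] at h2
    rw [kleinHull_eq_union hq hq1] at h1
    exact h1.resolve_left h2
  · intro ξ h
    exact ⟨by rw [kleinHull_eq_union hq hq1]; exact Or.inr h, fun h2 => disjoint_interior hq hq1 h2 h⟩

theorem zero_mem_kleinRegion {q : ℝ} : (0 : ℂ) ∈ kleinRegion q :=
  ⟨by simp, true, [], by simp [Tri, edge_nil, root, qf]⟩

/-! ### Disjointness of rational and irrational points -/

theorem dt_snd_ne_zero {s : State} (hs : 0 < dt s.1 s.2) {x : Fin 2 → ℝ} (hx : x ≠ 0)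
    (h : dt s.1 x = 0) : dt s.2 x ≠ 0 := by
  obtain ⟨c, hc, rfl⟩ := exists_smul_of_dt_eq_zero (ne_zero_of_dt_left hs.ne') hx h
  rw [dt_smul_right, dt_swap]
  exact mul_ne_zero hc (neg_ne_zero.2 hs.ne')

theorem letter_eq_false {q : ℝ} (hq : 0 < q) {d : Bool} {s : State} (hs : 0 < dt s.1 s.2)
    {x : Fin 2 → ℝ} (hx : x ≠ 0) (h : dt s.1 x = 0)
    (h' : dt (step q d s).1 x * dt (step q d s).2 x ≤ 0) : d = false := by
  have h2 := dt_snd_ne_zero hs hx h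
  cases d
  · rfl
  · rw [step_true, dt_add_left, h, zero_add, dt_smul_left] at h'
    have : 0 < q * dt s.2 x ^ 2 := by positivity
    nlinarith

theorem letter_eq_true {q : ℝ} (hq : 0 < q) {d : Bool} {s : State} (hs : 0 < dt s.1 s.2)
    {x : Fin 2 → ℝ} (hx : x ≠ 0) (h : dt s.2 x = 0)
    (h' : dt (step q d s).1 x * dt (step q d s).2 x ≤ 0) : d = true := by
  have h2 : dt s.1 x ≠ 0 := fun h3 => dt_snd_ne_zero hs hx h3 h
  cases d
  · rw [step_false, dt_smul_left, dt_add_left, h, add_zero] at h'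
    have : 0 < q * dt s.1 x ^ 2 := by positivity
    nlinarith
  · rfl

/-- A point beyond all edges of a path which is not eventually constant is not a vertex of these
edges. -/
theorem Beyond.dt_neg {q : ℝ} (hq : 0 < q) {b : Bool} {p : ℕ → Bool} (hp : Wild p)
    {x : Fin 2 → ℝ} (hx : x ≠ 0) (h : Beyond q b p (dir x)) (n : ℕ) :
    dt (edge q b (pre p n)).1 x * dt (edge q b (pre p n)).2 x < 0 := by
  have hB : ∀ n, dt (edge q b (pre p n)).1 x * dt (edge q b (pre p n)).2 x ≤ 0 := fun n =>
    (qf_dir_nonpos hx).1 (h.2 n)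
  have hnext : ∀ m, dt (step q (p m) (edge q b (pre p m))).1 x *
      dt (step q (p m) (edge q b (pre p m))).2 x ≤ 0 := fun m => by
    rw [← edge_pre_succ]; exact hB (m + 1)
  refine lt_of_le_of_ne (hB n) fun h0 => ?_
  rcases mul_eq_zero.1 h0 with h0 | h0
  -- Once the point is the left vertex, the path can only go left to stay beyond it; symmetrically
  -- the right vertex forces right moves. Either contradicts wildness.
  · have key : ∀ m ≥ n, dt (edge q b (pre p m)).1 x = 0 := by
      intro m hm
      induction m, hm using Nat.le_induction with
      | base => exact h0
      | succ m hm ih =>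
        rw [edge_pre_succ, letter_eq_false hq (dt_edge_pos hq b _) hx ih (hnext m), step_false]
        exact ih
    obtain ⟨m, hm, hpm⟩ := frequently_atTop.1 hp.2 n
    rw [letter_eq_false hq (dt_edge_pos hq b _) hx (key m hm) (hnext m)] at hpm
    exact absurd hpm (by decide)
  · have key : ∀ m ≥ n, dt (edge q b (pre p m)).2 x = 0 := by
      intro m hm
      induction m, hm using Nat.le_induction with
      | base => exact h0
      | succ m hm ih =>
        rw [edge_pre_succ, letter_eq_true hq (dt_edge_pos hq b _) hx ih (hnext m), step_true,
          dt_smul_left, ih, mul_zero]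
    obtain ⟨m, hm, hpm⟩ := frequently_atTop.1 hp.1 n
    rw [letter_eq_true hq (dt_edge_pos hq b _) hx (key m hm) (hnext m)] at hpm
    exact absurd hpm (by decide)

theorem eq_true_of_pre_prefix {p : ℕ → Bool} {g : List Bool}
    (h : ∀ n, ∃ k, pre p n <+: g ++ List.replicate k true) (m : ℕ) (hm : g.length ≤ m) :
    p m = true := by
  obtain ⟨k, t, ht⟩ := h (m + 1)
  have h1 := pre_getElem? p (Nat.lt_succ_self m)
  have h2 : (pre p (m + 1) ++ t)[m]? = Option.some (p m) := by
    rw [List.getElem?_append_left (by rw [length_pre]; omega), h1]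
  rw [ht, List.getElem?_append_right hm, List.getElem?_replicate] at h2
  split_ifs at h2
  exact (Option.some.inj h2).symm

/-- Irrational points lie on no rational chord. -/
theorem disjoint_kleinRat_kleinIrr {q : ℝ} (hq : 0 < q) (hq1 : q ≤ 1) :
    Disjoint (kleinRat q) (kleinIrr q) := by
  rw [Set.disjoint_left]
  rintro ξ ⟨-, b', g, h0⟩ ⟨b, p, hp, hB⟩
  obtain ⟨x, hx, rfl⟩ := exists_dir (hB.norm_eq_one hq hq1 hp.1)
  have key := hB.dt_neg hq hp hx
  rw [qf_dir_eq_zero hx] at h0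
  -- An endpoint of the chord at g strictly beyond every edge of the path forces each prefix to be a
  -- prefix of g followed by right moves, so the path would be eventually right.
  have hpre : ∀ n, ∃ k, pre p n <+: g ++ List.replicate k true := by
    intro n
    have hn := key n
    rcases mul_eq_zero.1 h0 with h0 | h0
    · obtain ⟨c, hc, rfl⟩ := exists_smul_of_dt_eq_zero (snd_ne_zero hq b' g) hx h0
      rw [dt_smul_right, dt_smul_right] at hn
      obtain ⟨-, h⟩ := prefix_of_edge hq (b := b) (b' := b') (h := pre p n) (g := g) (by
        have : 0 < c ^ 2 := by positivity
        by_contra hc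
        nlinarith [mul_nonneg this.le (not_lt.1 hc)])
      exact ⟨0, by simpa using h⟩
    · obtain ⟨c, hc, rfl⟩ := exists_smul_of_dt_eq_zero
        (flat_ne_zero (q := q) (dt_edge_pos hq b' g)) hx h0
      rw [dt_smul_right, dt_smul_right] at hn
      obtain ⟨-, h⟩ := prefix_of_edge_flat hq hq1 (b := b) (b' := b') (h := pre p n) (g := g) (by
        have : 0 < c ^ 2 := by positivity
        by_contra hc
        nlinarith [mul_nonneg this.le (not_lt.1 hc)])
      exact h
  obtain ⟨m, hm, hpm⟩ := frequently_atTop.1 hp.1 g.length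
  rw [eq_true_of_pre_prefix hpre m hm] at hpm
  exact absurd hpm (by decide)

/-! ### The deformed rationals as vertices of the tessellation -/

theorem frac_smul_const {c : ℝ} (hc : c ≠ 0) (v : Fin 2 → ℝ) : frac (c • v) = frac v := by
  unfold frac
  by_cases h : v 1 = 0
  · simp [h]
  · simp [h, hc, mul_div_mul_left _ _ hc]

theorem smul_frac (g : GL (Fin 2) ℝ) {v : Fin 2 → ℝ} (hv : v ≠ 0) :
    g • frac v = frac ![g 0 0 * v 0 + g 0 1 * v 1, g 1 0 * v 0 + g 1 1 * v 1] := by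
  unfold frac
  by_cases h : v 1 = 0
  · have h0 : v 0 ≠ 0 := by
      intro h0; apply hv; ext i; fin_cases i <;> simp [h, h0]
    rw [if_pos h, smul_infty_eq_ite]
    by_cases hg : g 1 0 = 0
    · simp [h, hg]
    · simp [h, hg, h0, mul_div_mul_right _ _ h0]
  · rw [if_neg h, smul_some_eq_ite]
    have e : g 1 0 * (v 0 / v 1) + g 1 1 = (g 1 0 * v 0 + g 1 1 * v 1) / v 1 := by
      field_simp
    rw [e]
    by_cases hg : g 1 0 * v 0 + g 1 1 * v 1 = 0
    · simp [hg]
    · rw [if_neg (div_ne_zero hg h), if_neg (by simpa using hg)]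
      simp only [Matrix.cons_val_zero, Matrix.cons_val_one]
      norm_cast
      field_simp

/-! ### Generators acting on edges -/

theorem sigma1_smul_frac {q : ℝ} (hq : 0 < q) {v : Fin 2 → ℝ} (hv : v ≠ 0) :
    sigma1 q • frac v = frac ![v 0 - v 1, q * v 1] := by
  rw [smul_frac _ hv, ← frac_smul_const hq.ne']
  congr 1
  have := hq.ne'
  ext i
  fin_cases i
  · simp [sigma1, hq.ne', Matrix.GeneralLinearGroup.mkOfDetNeZero]
    field_simp
    ring
  · simp [sigma1, hq.ne', Matrix.GeneralLinearGroup.mkOfDetNeZero]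

theorem sigma2_smul_frac {q : ℝ} (hq : 0 < q) {v : Fin 2 → ℝ} (hv : v ≠ 0) :
    sigma2 q • frac v = frac ![q * v 0, q * v 0 + v 1] := by
  rw [smul_frac _ hv, ← frac_smul_const hq.ne']
  congr 1
  have := hq.ne'
  ext i
  fin_cases i
  · simp [sigma2, hq.ne', Matrix.GeneralLinearGroup.mkOfDetNeZero]
  · simp [sigma2, hq.ne', Matrix.GeneralLinearGroup.mkOfDetNeZero]
    field_simp

/-- The linear combination of the two vertices of an edge with given coefficients. -/
def lin (c : Fin 2 → ℝ) (s : State) : Fin 2 → ℝ := c 0 • s.1 + c 1 • s.2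

theorem lin_ne_zero {c : Fin 2 → ℝ} (hc : c ≠ 0) {s : State} (hs : 0 < dt s.1 s.2) :
    lin c s ≠ 0 := by
  intro h
  have h1 : dt s.1 (lin c s) = 0 := by rw [h]; simp [dt]
  have h2 : dt s.2 (lin c s) = 0 := by rw [h]; simp [dt]
  simp only [lin, dt_add_right, dt_smul_right, dt_self, dt_swap s.2 s.1, mul_zero, zero_add,
    add_zero, mul_neg, neg_eq_zero, mul_eq_zero, hs.ne', or_false] at h1 h2
  apply hc
  ext i; fin_cases i <;> simp [h1, h2]

theorem exists_lin_step (q : ℝ) (d : Bool) (c : Fin 2 → ℝ) :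
    ∃ c', ∀ s, lin c (step q d s) = lin c' s := by
  cases d
  · refine ⟨![c 0 + q * c 1, q * c 1], fun s => ?_⟩
    simp only [lin, step_false, Matrix.cons_val_zero, Matrix.cons_val_one]; module
  · refine ⟨![c 0, c 0 + q * c 1], fun s => ?_⟩
    simp only [lin, step_true, Matrix.cons_val_zero, Matrix.cons_val_one]; module

theorem exists_lin_run (q : ℝ) (l : List Bool) (c : Fin 2 → ℝ) :
    ∃ c', ∀ s, lin c (run q l s) = lin c' s := by
  induction l with
  | nil => exact ⟨c, fun s => rfl⟩
  | cons d l ih =>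
    obtain ⟨c', h⟩ := ih
    obtain ⟨c'', h'⟩ := exists_lin_step q d c'
    exact ⟨c'', fun s => by rw [run, h, h']⟩

/-- The generator moving the root edge of a half to one of its children. -/
def gen (q : ℝ) : Bool → Bool → GL (Fin 2) ℝ
  | true, true => (sigma1 q)⁻¹
  | true, false => sigma2 q
  | false, false => sigma1 q
  | false, true => (sigma2 q)⁻¹

theorem gen_smul {q : ℝ} (hq : 0 < q) (b d : Bool) {c : Fin 2 → ℝ} (hc : c ≠ 0) :
    gen q b d • frac (lin c (root q b)) = frac (lin c (step q d (root q b))) := by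
  have hr : ∀ b, lin c (root q b) ≠ 0 := fun b => lin_ne_zero hc (dt_root_pos hq b)
  have hs : ∀ b d, lin c (step q d (root q b)) ≠ 0 := fun b d =>
    lin_ne_zero hc (by rw [dt_step]; exact mul_pos hq (dt_root_pos hq b))
  cases b <;> cases d <;> simp only [gen]
  · rw [sigma1_smul_frac hq (hr _)]
    congr 1
    ext i
    fin_cases i <;> simp [lin, root, step] <;> ring
  · rw [inv_smul_eq_iff, sigma2_smul_frac hq (hs _ _), ← frac_smul_const hq.ne']
    congr 1
    ext i
    fin_cases i <;> simp [lin, root, step]; ring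
  · rw [sigma2_smul_frac hq (hr _)]
    congr 1
    ext i
    fin_cases i <;> simp [lin, root, step] <;> ring
  · rw [inv_smul_eq_iff, sigma1_smul_frac hq (hs _ _), ← frac_smul_const hq.ne']
    congr 1
    ext i
    fin_cases i
    · simp [lin, root, step]; ring
    · simp [lin, root, step]

/-- Following the tail of the word is linear in the starting edge, so it only changes the
coefficients c. The generator of the first letter then carries the root edge to its child, which is
why matrices multiply in the order of the letters. -/
theorem prod_gen_smul {q : ℝ} (hq : 0 < q) (b : Bool) (l : List Bool) {c : Fin 2 → ℝ}
    (hc : c ≠ 0) :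
    (l.map (gen q b)).prod • frac (lin c (root q b)) = frac (lin c (edge q b l)) := by
  induction l with
  | nil => simp [edge_nil]
  | cons d l ih =>
    obtain ⟨c', h⟩ := exists_lin_run q l c
    have hc' : c' ≠ 0 := by
      rintro rfl
      apply lin_ne_zero hc (dt_edge_pos hq b l)
      unfold edge
      rw [h]; simp [lin]
    rw [List.map_cons, List.prod_cons, mul_smul, ih]
    unfold edge
    rw [h, gen_smul hq b d hc', run, h]

/-- The sign of a half. -/
def sgn (b : Bool) : ℤ := if b then 1 else -1

/-- Lists of even length whose entries have a given weak sign, strict at even places. -/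
inductive Alt (b : Bool) : List ℤ → Prop
  | nil : Alt b []
  | cons {a c : ℤ} {l : List ℤ} (ha : 0 ≤ sgn b * a) (hc : 1 ≤ sgn b * c) (h : Alt b l) :
      Alt b (a :: c :: l)

theorem alt_of_forall (b : Bool) : ∀ l : List ℤ, Even l.length → (∀ x ∈ l, 1 ≤ sgn b * x) → Alt b l
  | [], _, _ => Alt.nil
  | [a], h, _ => by simp at h
  | a :: c :: l, h, hl => Alt.cons (by linarith [hl a (by simp)]) (hl c (by simp))
      (alt_of_forall b l (by simpa [Nat.even_add_one] using h) fun x hx => hl x (by simp [hx]))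

theorem alt_of_isPosCF (b : Bool) {l : List ℤ} (h : Even l.length)
    (hl : IsPosCF (l.map fun a => sgn b * a)) : Alt b l := by
  match l, h, hl with
  | [], _, _ => exact Alt.nil
  | [a], h, _ => simp at h
  | a :: c :: l, h, hl =>
    exact Alt.cons hl.1 (hl.2 _ (by simp)) (alt_of_forall b l (by simpa [Nat.even_add_one] using h)
      fun x hx => hl.2 _ (List.mem_map_of_mem (by simp [hx])))

/-- The word of a continued fraction expansion. -/
def cfWord (b : Bool) : List ℤ → List Bool
  | a :: c :: l => List.replicate a.natAbs b ++ List.replicate c.natAbs (!b) ++ cfWord b l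
  | _ => []

theorem beta_eq_prod (q : ℝ) {b : Bool} {l : List ℤ} (h : Alt b l) :
    beta q l = ((cfWord b l).map (gen q b)).prod := by
  induction h with
  | nil => rfl
  | @cons a c l ha hc h ih =>
    rw [beta, cfWord, List.map_append, List.map_append, List.prod_append, List.prod_append, ih,
      List.map_replicate, List.map_replicate, List.prod_replicate, List.prod_replicate]
    congr 1
    cases b
    · simp only [sgn, Bool.false_eq_true, if_false] at ha hc
      simp only [gen, Bool.not_false]
      congr 1
      · rw [← zpow_natCast]; congr 1; omega
      · rw [inv_pow, ← zpow_natCast, ← zpow_neg]; congr 1; omega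
    · simp only [sgn, if_true] at ha hc
      simp only [gen, Bool.not_true]
      congr 1
      · rw [inv_pow, ← zpow_natCast, ← zpow_neg]; congr 1; omega
      · rw [← zpow_natCast]; congr 1; omega

/-- In the negative half the image of ∞ is a left vertex. A final right move makes it the mediant of
the preceding edge, hence the right vertex of the sibling. -/
theorem cfWord_false_snoc {l : List ℤ} (h : Alt false l) (hl : l ≠ []) :
    ∃ m, cfWord false l = m ++ [true] := by
  induction h with
  | nil => exact absurd rfl hl
  | @cons a c l ha hc h ih =>
    rw [cfWord]
    by_cases h0 : l = []
    · subst h0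
      simp only [sgn, Bool.false_eq_true, if_false] at hc
      obtain ⟨k, hk⟩ : ∃ k, c.natAbs = k + 1 := ⟨c.natAbs - 1, by omega⟩
      refine ⟨List.replicate a.natAbs false ++ List.replicate k true, ?_⟩
      rw [hk, List.replicate_succ']; simp [cfWord]
    · obtain ⟨m, hm⟩ := ih h0
      exact ⟨List.replicate a.natAbs false ++ List.replicate c.natAbs (!false) ++ m, by
        rw [hm, List.append_assoc _ m]⟩

theorem vec_ne_zero_of_fst {t s : ℝ} (h : t ≠ 0) : ![t, s] ≠ 0 := fun h' => h (congrFun h' 0)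

theorem vec_ne_zero_of_snd {t s : ℝ} (h : s ≠ 0) : ![t, s] ≠ 0 := fun h' => h (congrFun h' 1)

theorem sigma1_one_zpow_smul (a : ℤ) {t s : ℝ} (h : s ≠ 0) :
    sigma1 1 ^ (-a) • frac ![t, s] = frac ![t + a * s, s] := by
  induction a generalizing t with
  | zero => simp
  | succ a ih =>
    rw [neg_add, zpow_add, mul_smul]
    have : sigma1 1 ^ (-1 : ℤ) • frac ![t, s] = frac ![t + s, s] := by
      rw [zpow_neg_one, inv_smul_eq_iff, sigma1_smul_frac one_pos (vec_ne_zero_of_snd h)]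
      simp
    rw [this, ih]
    push_cast
    ring_nf
  | pred a ih =>
    rw [sub_eq_add_neg, neg_add, neg_neg 1, zpow_add, mul_smul, zpow_one,
      sigma1_smul_frac one_pos (vec_ne_zero_of_snd h)]
    simp only [Matrix.cons_val_zero, Matrix.cons_val_one, one_mul]
    rw [ih]
    push_cast
    ring_nf

theorem sigma2_one_zpow_smul (a : ℤ) {t s : ℝ} (h : t ≠ 0) :
    sigma2 1 ^ a • frac ![t, s] = frac ![t, s + a * t] := by
  induction a generalizing s with
  | zero => simp
  | succ a ih =>
    rw [zpow_add, mul_smul, zpow_one, sigma2_smul_frac one_pos (vec_ne_zero_of_fst h)]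
    simp only [Matrix.cons_val_zero, Matrix.cons_val_one, one_mul]
    rw [ih]
    push_cast
    ring_nf
  | pred a ih =>
    rw [sub_eq_add_neg, zpow_add, mul_smul]
    have : sigma2 1 ^ (-1 : ℤ) • frac ![t, s] = frac ![t, s - t] := by
      rw [zpow_neg_one, inv_smul_eq_iff, sigma2_smul_frac one_pos (vec_ne_zero_of_fst h)]
      simp
    rw [this, ih]
    push_cast
    ring_nf

theorem frac_one_zero : frac ![1, 0] = ∞ := by simp [frac]

/-- At q = 1 the generators act by integer shears, which reproduce the continued fraction recursion.
The coherent signs keep both coordinates away from zero where a division is needed. -/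
theorem beta_one_smul_infty {b : Bool} {l : List ℤ} (h : Alt b l) :
    ∃ t s : ℝ, 0 < t ∧ 0 ≤ (sgn b : ℝ) * s ∧ (l ≠ [] → s ≠ 0) ∧ s = t * (cfValue l : ℝ)⁻¹ ∧
      beta 1 l • (∞ : OnePoint ℝ) = frac ![t, s] := by
  induction h with
  | nil => exact ⟨1, 0, one_pos, by simp, by simp, by simp [cfValue], by simp [beta, frac_one_zero]⟩
  | @cons a c l ha hc h ih =>
    obtain ⟨t, s, ht, hs, -, he, hb⟩ := ih
    have hc' : (1 : ℝ) ≤ sgn b * c := by exact_mod_cast hc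
    have ha' : (0 : ℝ) ≤ sgn b * a := by exact_mod_cast ha
    have hsq : (sgn b : ℝ) * sgn b = 1 := by cases b <;> simp [sgn]
    have hpos : 0 < (sgn b : ℝ) * (s + c * t) := by nlinarith
    have hne : s + c * t ≠ 0 := by rintro h0; rw [h0, mul_zero] at hpos; exact hpos.false
    have e : a * (s + c * t) = (sgn b * a) * (sgn b * (s + c * t)) := by
      calc a * (s + c * t) = ((sgn b : ℝ) * sgn b) * (a * (s + c * t)) := by rw [hsq, one_mul]
        _ = _ := by ring
    have htp : 0 < t + a * (s + c * t) := by rw [e]; nlinarith [mul_nonneg ha' hpos.le]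
    refine ⟨t + a * (s + c * t), s + c * t, htp, hpos.le, fun _ => hne, ?_, ?_⟩
    · have e2 : (cfValue (a :: c :: l) : ℝ) = (t + a * (s + c * t)) / (s + c * t) := by
        simp only [cfValue]
        push_cast
        have : (cfValue l : ℝ)⁻¹ = s / t := by rw [he]; field_simp
        rw [this]
        have h1 : (c : ℝ) + s / t = (s + c * t) / t := by field_simp; ring
        rw [h1, inv_div, add_div, mul_div_assoc, div_self hne, mul_one, add_comm]
      rw [e2, inv_div, mul_div_cancel₀ _ htp.ne']
    · rw [beta, mul_smul, mul_smul, hb, sigma2_one_zpow_smul c ht.ne', sigma1_one_zpow_smul a hne]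

/-- Every pair of deformed rationals comes from an edge with an address independent of `q`. -/
theorem exists_word (x : OnePoint ℚ) : ∃ b l, (∀ q : ℝ, 0 < q → q ≤ 1 →
    rightRat q x = frac (edge q b l).2 ∧ leftRat q x = frac (flat q (edge q b l))) ∧
    rightRat 1 x = OnePoint.map (fun r : ℚ => (r : ℝ)) x := by
  have hx : IsEvenCF (evenCF x) x := (exists_isEvenCF x).choose_spec
  have htrue : ∀ l, Alt true l → ∀ q : ℝ, 0 < q → q ≤ 1 →
      beta q l • (∞ : OnePoint ℝ) = frac (edge q true (cfWord true l)).2 ∧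
      beta q l • frac ![1, 1 - q] = frac (flat q (edge q true (cfWord true l))) := by
    intro l hl q hq hq1
    have h1 := prod_gen_smul hq true (cfWord true l) (vec_ne_zero_of_snd (t := 0) one_ne_zero)
    -- The coefficients (1 - q, 1) are those of `flat`, and at the root they give the vector (1, 1 -
    -- q).
    have h2 := prod_gen_smul hq true (cfWord true l) (vec_ne_zero_of_snd (t := 1 - q) one_ne_zero)
    rw [← beta_eq_prod q hl] at h1 h2
    constructor
    · rw [← frac_one_zero]
      simpa [lin, root] using h1
    · simpa [lin, root, flat] using h2
  have hval : ∀ r : ℚ, r ≠ 0 → ∀ b, Alt b (evenCF r) → cfValue (evenCF r) = r →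
      rightRat 1 (r : OnePoint ℚ) = ((r : ℝ) : OnePoint ℝ) := by
    intro r hr b hb hv
    obtain ⟨t, s, ht, -, hs, he, hb⟩ := beta_one_smul_infty hb
    rw [hv] at he
    have hr' : (r : ℝ) ≠ 0 := by exact_mod_cast hr
    have hs : s ≠ 0 := by rw [he]; exact mul_ne_zero ht.ne' (inv_ne_zero hr')
    rw [rightRat, hb, frac, if_neg (by simpa using hs)]
    congr 1
    simp only [Matrix.cons_val_zero, Matrix.cons_val_one]
    rw [he]; field_simp
  induction x using OnePoint.rec with
  | infty =>
    have hx : evenCF ∞ = [] := hx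
    refine ⟨true, [], fun q hq hq1 => ?_, ?_⟩
    · rw [rightRat, leftRat, hx]
      exact htrue [] Alt.nil q hq hq1
    · rw [rightRat, hx]; simp [beta]
  | coe r =>
    replace hx : if r = 0 then evenCF r = [-1, 1] else Even (evenCF r).length ∧
      (IsPosCF (evenCF r) ∨ IsPosCF ((evenCF r).map (fun a => -a))) ∧ cfValue (evenCF r) = r := hx
    by_cases hr : r = 0
    · rw [if_pos hr] at hx
      -- The expansion [-1, 1] of 0 has mixed signs and spells no word, so it is computed by hand.
      have key : ∀ q : ℝ, 0 < q → ∀ v : Fin 2 → ℝ, v ≠ 0 → q * v 0 + v 1 ≠ 0 →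
          beta q [-1, 1] • frac v = frac ![- v 1, q * (q * v 0 + v 1)] := by
        intro q hq v hv hv'
        rw [beta, beta, mul_smul, mul_smul, one_smul, neg_neg, zpow_one, zpow_one,
          sigma2_smul_frac hq hv, sigma1_smul_frac hq (vec_ne_zero_of_snd hv')]
        simp
      have hz : ∀ q : ℝ, 0 < q → rightRat q (r : OnePoint ℚ) = ((0 : ℝ) : OnePoint ℝ) := by
        intro q hq
        rw [rightRat, hx, ← frac_one_zero, key q hq _ (vec_ne_zero_of_fst one_ne_zero)
          (by simp [hq.ne'])]
        simp [frac, hq.ne']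
      refine ⟨false, [], fun q hq hq1 => ⟨?_, ?_⟩, ?_⟩
      · rw [hz q hq]; simp [edge_nil, root, frac, hq.ne']
      · rw [leftRat, hx, key q hq _ (vec_ne_zero_of_fst one_ne_zero) (by simp)]
        simp only [flat, edge_nil, root]
        congr 1
        ext i; fin_cases i <;> simp
      · rw [hz 1 one_pos]; simp [hr]
    · rw [if_neg hr] at hx
      obtain ⟨he, hp | hp, hv⟩ := hx
      · have hA : Alt true (evenCF r) := alt_of_isPosCF true he (by simpa [sgn] using hp)
        exact ⟨true, _, htrue _ hA, hval r hr true hA hv⟩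
      · have hA : Alt false (evenCF r) := alt_of_isPosCF false he (by simpa [sgn] using hp)
        have hne : evenCF r ≠ [] := by
          intro h0; rw [h0] at hv; exact hr hv.symm
        obtain ⟨m, hm⟩ := cfWord_false_snoc hA hne
        refine ⟨false, m ++ [false], fun q hq hq1 => ?_, hval r hr false hA hv⟩
        have h1 := prod_gen_smul hq false (cfWord false (evenCF r))
          (vec_ne_zero_of_fst (s := 0) one_ne_zero)
        -- The coefficients (-q, 1 - q) express q (1, 1 - q) in the vertices (-1, 0) and (0, q) of
        -- the negative root.
        have h2 := prod_gen_smul hq false (cfWord false (evenCF r))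
          (vec_ne_zero_of_fst (t := - q) (s := 1 - q) (neg_ne_zero.2 hq.ne'))
        rw [← beta_eq_prod q hA, hm, edge_snoc] at h1 h2
        rw [rightRat, leftRat, edge_snoc]
        constructor
        · have e : lin ![1, 0] (root q false) = ![-1, 0] := by
            ext i; fin_cases i <;> simp [lin, root]
          rw [e] at h1
          have e' : frac ![-1, 0] = ∞ := by simp [frac]
          rw [← e', h1, step_false, frac_smul_const hq.ne', step_true]
          simp [lin]
        · have e : lin ![-q, 1 - q] (root q false) = q • ![1, 1 - q] := by
            ext i; fin_cases i <;> simp [lin, root]; ring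
          rw [e, frac_smul_const hq.ne'] at h2
          rw [h2, ← frac_smul_const (neg_ne_zero.2 hq.ne') (flat q _)]
          congr 1
          simp only [lin, step_true, step_false, flat, Matrix.cons_val_zero, Matrix.cons_val_one]
          module

/-! ### Every edge belongs to a rational number -/

theorem dt_eq_zero_of_frac_eq {u v : Fin 2 → ℝ} (h : frac u = frac v) : dt u v = 0 := by
  unfold frac at h
  unfold dt
  split_ifs at h with h1 h2 h2
  · rw [h1, h2]; ring
  · exact absurd h (infty_ne_coe _)
  · exact absurd h (coe_ne_infty _)
  · rw [OnePoint.coe_eq_coe, div_eq_div_iff h1 h2] at h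
    linarith

theorem frac_eq_of_dt {u v : Fin 2 → ℝ} (hu : u ≠ 0) (hv : v ≠ 0) (h : dt u v = 0) :
    frac u = frac v := by
  obtain ⟨c, hc, rfl⟩ := exists_smul_of_dt_eq_zero hu hv h
  exact (frac_smul_const hc u).symm

theorem exists_rat_entries (b : Bool) (l : List Bool) :
    (∀ i, ∃ r : ℚ, (edge 1 b l).1 i = r) ∧ ∀ i, ∃ r : ℚ, (edge 1 b l).2 i = r := by
  induction l using List.reverseRecOn with
  | nil =>
    cases b
    · exact ⟨fun i => by fin_cases i; exacts [⟨-1, by simp [edge_nil, root]⟩,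
        ⟨0, by simp [edge_nil, root]⟩], fun i => by fin_cases i; exacts
        [⟨0, by simp [edge_nil, root]⟩, ⟨1, by simp [edge_nil, root]⟩]⟩
    · exact ⟨fun i => by fin_cases i; exacts [⟨0, by simp [edge_nil, root]⟩,
        ⟨1, by simp [edge_nil, root]⟩], fun i => by fin_cases i; exacts
        [⟨1, by simp [edge_nil, root]⟩, ⟨0, by simp [edge_nil, root]⟩]⟩
  | append_singleton l d ih =>
    obtain ⟨h1, h2⟩ := ih
    have h3 : ∀ i, ∃ r : ℚ, ((edge 1 b l).1 + (edge 1 b l).2) i = r := fun i => by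
      obtain ⟨r, hr⟩ := h1 i
      obtain ⟨r', hr'⟩ := h2 i
      exact ⟨r + r', by rw [Pi.add_apply, hr, hr']; push_cast; rfl⟩
    rw [edge_snoc]
    cases d
    · rw [step_false, one_smul]; exact ⟨h1, h3⟩
    · rw [step_true, one_smul]; exact ⟨h3, h2⟩

theorem exists_rat_of_word (b : Bool) (l : List Bool) :
    ∃ x : OnePoint ℚ, OnePoint.map (fun r : ℚ => (r : ℝ)) x = frac (edge 1 b l).2 := by
  have h := (exists_rat_entries b l).2
  obtain ⟨r, hr⟩ := h 0
  obtain ⟨s, hs⟩ := h 1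
  unfold frac
  rw [hr, hs]
  by_cases h0 : (s : ℝ) = 0
  · exact ⟨∞, by rw [if_pos h0]; rfl⟩
  · exact ⟨((r / s : ℚ) : OnePoint ℚ), by rw [if_neg h0, map_some]; push_cast; rfl⟩

theorem exists_strip (l : List Bool) : ∃ m k, l = m ++ List.replicate k true ∧
    (m = [] ∨ ∃ g, m = g ++ [false]) := by
  induction l using List.reverseRecOn with
  | nil => exact ⟨[], 0, rfl, Or.inl rfl⟩
  | append_singleton l d ih =>
    cases d
    · exact ⟨l ++ [false], 0, by simp, Or.inr ⟨l, rfl⟩⟩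
    · obtain ⟨m, k, rfl, h⟩ := ih
      exact ⟨m, k + 1, by rw [List.replicate_succ', List.append_assoc], h⟩

theorem dt_mid_neg {q : ℝ} (hq : 0 < q) (b : Bool) (g : List Bool) :
    dt (edge q b g).1 (edge q b (g ++ [false])).2 * dt (edge q b g).2 (edge q b (g ++ [false])).2
      < 0 := by
  have hd := dt_edge_pos hq b g
  rw [edge_snoc, step_false]
  simp only [dt_smul_right, dt_add_right, dt_self, dt_swap (edge q b g).2 (edge q b g).1]
  nlinarith [mul_pos hq hd]

/-- The vertex created below g is strictly inside the cone of g, so every edge having it as right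
vertex sits properly below g. -/
theorem prefix_of_dt_eq_zero {q : ℝ} (hq : 0 < q) {b b' : Bool} {g l : List Bool}
    (h : dt (edge q b (g ++ [false])).2 (edge q b' l).2 = 0) : b = b' ∧ g <+: l ∧ l ≠ g := by
  obtain ⟨c, hc, e⟩ := exists_smul_of_dt_eq_zero (snd_ne_zero hq b _) (snd_ne_zero hq b' l) h
  have hlt : dt (edge q b g).1 (edge q b' l).2 * dt (edge q b g).2 (edge q b' l).2 < 0 := by
    rw [e, dt_smul_right, dt_smul_right]
    have : 0 < c ^ 2 := by positivity
    nlinarith [mul_neg_of_pos_of_neg this (dt_mid_neg hq b g)]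
  obtain ⟨rfl, h2⟩ := prefix_of_edge hq hlt
  refine ⟨rfl, h2, ?_⟩
  rintro rfl
  rw [dt_self, mul_zero] at hlt
  exact hlt.false

/-- Distinct right vertices have distinct addresses, up to moves to the right. -/
theorem word_unique {q : ℝ} (hq : 0 < q) {b b' : Bool} {l l' : List Bool}
    (h : dt (edge q b l).2 (edge q b' l').2 = 0) :
    b = b' ∧ ∃ m k k', l = m ++ List.replicate k true ∧ l' = m ++ List.replicate k' true := by
  obtain ⟨m, k, rfl, hm⟩ := exists_strip l
  obtain ⟨m', k', rfl, hm'⟩ := exists_strip l'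
  rw [edge_append, edge_append, snd_run_true, snd_run_true, dt_smul_left, dt_smul_right] at h
  have h : dt (edge q b m).2 (edge q b' m').2 = 0 := by
    have h1 := pow_pos hq k
    have h2 := pow_pos hq k'
    simpa [h1.ne', h2.ne'] using h
  have h' : dt (edge q b' m').2 (edge q b m).2 = 0 := by rw [dt_swap, h, neg_zero]
  suffices hs : b = b' ∧ m = m' by
    obtain ⟨rfl, rfl⟩ := hs
    exact ⟨rfl, m, k, k', rfl, rfl⟩
  rcases hm with rfl | ⟨g, rfl⟩ <;> rcases hm' with rfl | ⟨g', rfl⟩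
  · refine ⟨?_, rfl⟩
    cases b <;> cases b' <;> first | rfl | skip
    · simp [edge_nil, root, dt, hq.ne'] at h
    · simp [edge_nil, root, dt, hq.ne'] at h
  · obtain ⟨-, h1, h2⟩ := prefix_of_dt_eq_zero hq h'
    exact absurd (List.prefix_nil.1 h1).symm h2
  · obtain ⟨-, h1, h2⟩ := prefix_of_dt_eq_zero hq h
    exact absurd (List.prefix_nil.1 h1).symm h2
  · obtain ⟨rfl, h1, h2⟩ := prefix_of_dt_eq_zero hq h
    obtain ⟨-, h3, h4⟩ := prefix_of_dt_eq_zero hq h'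
    -- Each of g, g' is a prefix of the other followed by one letter, and is not equal to that
    -- longer word; so they are prefixes of each other.
    have h1 := (List.prefix_concat_iff.1 h1).resolve_left fun h => h2 h.symm
    have h3 := (List.prefix_concat_iff.1 h3).resolve_left fun h => h4 h.symm
    rw [h1.eq_of_length (le_antisymm h1.length_le h3.length_le)]
    exact ⟨rfl, rfl⟩

/-- At q = 1 the right vertex is an ordinary rational x. The word of x can differ from l only by
trailing right moves, and for every q these change neither the right vertex as a point nor `flat`.
-/
theorem exists_rat_curve (b : Bool) (l : List Bool) : ∃ x : OnePoint ℚ, ∀ q : ℝ, 0 < q → q ≤ 1 →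
    rightRat q x = frac (edge q b l).2 ∧ leftRat q x = frac (flat q (edge q b l)) := by
  obtain ⟨x, hx⟩ := exists_rat_of_word b l
  obtain ⟨b', l', h1, h2⟩ := exists_word x
  have h0 : frac (edge 1 b l).2 = frac (edge 1 b' l').2 := by
    rw [← hx, ← h2, (h1 1 one_pos le_rfl).1]
  obtain ⟨rfl, m, k, k', rfl, rfl⟩ := word_unique one_pos (dt_eq_zero_of_frac_eq h0)
  refine ⟨x, fun q hq hq1 => ?_⟩
  have hk := (pow_pos hq k).ne'
  have hk' := (pow_pos hq k').ne'
  obtain ⟨h3, h4⟩ := h1 q hq hq1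
  rw [h3, h4]
  simp only [edge_append, snd_run_true, flat_run_true, frac_smul_const hk, frac_smul_const hk',
    and_self]

/-! ### The Klein model -/

/-- The map of the Riemann sphere to the closed disc which is stereographic projection followed by
an orthogonal projection; it maps the closed upper half plane to the Klein model. -/
def klein : OnePoint ℂ → ℂ
  | ∞ => 1
  | (z : ℂ) => ⟨(Complex.normSq z - 1) / (Complex.normSq z + 1), 2 * z.re / (Complex.normSq z + 1)⟩

theorem klein_infty : klein ∞ = 1 := rfl

theorem klein_coe (z : ℂ) : klein (z : OnePoint ℂ) =
    ⟨(Complex.normSq z - 1) / (Complex.normSq z + 1), 2 * z.re / (Complex.normSq z + 1)⟩ := rfl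

theorem normSq_add_one_pos (z : ℂ) : 0 < Complex.normSq z + 1 := by
  have := Complex.normSq_nonneg z
  linarith

theorem continuous_klein : Continuous klein := by
  rw [OnePoint.continuous_iff]
  constructor
  · rw [klein_infty, coclosedCompact_eq_cocompact, Metric.tendsto_nhds]
    intro ε hε
    filter_upwards [(tendsto_norm_cocompact_atTop (E := ℂ)).eventually_gt_atTop (2 / ε)] with z hz
    have hp := normSq_add_one_pos z
    rw [dist_eq_norm]
    refine lt_of_pow_lt_pow_left₀ 2 hε.le ?_
    rw [div_lt_iff₀ hε] at hz
    have h1 : ‖klein z - 1‖ ^ 2 ≤ 4 / (Complex.normSq z + 1) := by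
      rw [Complex.sq_norm, Complex.normSq_apply, klein_coe, Complex.sub_re, Complex.sub_im]
      simp only [Complex.one_re, Complex.one_im, sub_zero]
      have e : (Complex.normSq z - 1) / (Complex.normSq z + 1) - 1 =
          -2 / (Complex.normSq z + 1) := by field_simp; ring
      rw [e, ← sub_nonneg]
      have : 4 / (Complex.normSq z + 1) - (-2 / (Complex.normSq z + 1) *
          (-2 / (Complex.normSq z + 1)) + 2 * z.re / (Complex.normSq z + 1) *
          (2 * z.re / (Complex.normSq z + 1))) = 4 * z.im ^ 2 / (Complex.normSq z + 1) ^ 2 := by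
        field_simp
        rw [Complex.normSq_apply]
        ring
      rw [this]
      positivity
    refine h1.trans_lt ?_
    rw [div_lt_iff₀ hp, Complex.normSq_eq_norm_sq]
    nlinarith [mul_pos hε hε]
  · have : (fun x : ℂ => klein x) = fun z : ℂ =>
        (((Complex.normSq z - 1) / (Complex.normSq z + 1) : ℝ) : ℂ) +
        ((2 * z.re / (Complex.normSq z + 1) : ℝ) : ℂ) * Complex.I := by
      ext z
      rw [klein_coe]
      apply Complex.ext
      · rw [Complex.add_re, Complex.re_ofReal_mul, Complex.ofReal_re, Complex.I_re]; ring
      · rw [Complex.add_im, Complex.im_ofReal_mul, Complex.ofReal_im, Complex.I_im]; ring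
    rw [this]
    have h1 : ∀ z : ℂ, Complex.normSq z + 1 ≠ 0 := fun z => (normSq_add_one_pos z).ne'
    have h2 := Complex.continuous_normSq
    refine (Complex.continuous_ofReal.comp ?_).add ((Complex.continuous_ofReal.comp ?_).mul
      continuous_const)
    · exact (h2.sub continuous_const).div (h2.add continuous_const) h1
    · exact (continuous_const.mul Complex.continuous_re).div (h2.add continuous_const) h1

/-- Up to a positive factor, the affine function of a chord pulls back to the equation of the circle
or line carrying the geodesic. -/
theorem qf_klein (u v : Fin 2 → ℝ) (z : ℂ) : qf u v (klein z) * ((Complex.normSq z + 1) / 2) =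
    u 1 * v 1 * Complex.normSq z - (u 0 * v 1 + u 1 * v 0) * z.re + u 0 * v 0 := by
  have := (normSq_add_one_pos z).ne'
  rw [klein_coe, qf]
  field_simp
  ring

theorem one_sub_normSq_klein (z : ℂ) : 1 - ((klein z).re ^ 2 + (klein z).im ^ 2) =
    4 * z.im ^ 2 / (Complex.normSq z + 1) ^ 2 := by
  have := (normSq_add_one_pos z).ne'
  rw [klein_coe]
  field_simp
  rw [Complex.normSq_apply]
  ring

theorem norm_klein_le (p : OnePoint ℂ) : ‖klein p‖ ≤ 1 := by
  induction p using OnePoint.rec with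
  | infty => simp [klein_infty]
  | coe z =>
    rw [norm_le_one_iff, ← sub_nonneg, one_sub_normSq_klein]
    positivity

theorem norm_klein_planeIncl (z : ℍ) : ‖klein (planeIncl z)‖ < 1 := by
  rw [norm_lt_one_iff, ← sub_pos, planeIncl, one_sub_normSq_klein]
  have := normSq_add_one_pos (z : ℂ)
  have h : 0 < (z : ℂ).im := z.im_pos
  positivity

theorem exists_frac (y : OnePoint ℝ) : ∃ v : Fin 2 → ℝ, v ≠ 0 ∧ y = frac v := by
  induction y using OnePoint.rec with
  | infty => exact ⟨![1, 0], vec_ne_zero_of_fst one_ne_zero, frac_one_zero.symm⟩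
  | coe t => exact ⟨![t, 1], vec_ne_zero_of_snd one_ne_zero, by simp [frac]⟩

theorem klein_circleIncl_frac {v : Fin 2 → ℝ} (hv : v ≠ 0) :
    klein (circleIncl (frac v)) = dir v := by
  have hl := len2_pos hv
  unfold frac circleIncl
  by_cases h : v 1 = 0
  · rw [if_pos h, map_infty, klein_infty]
    unfold len2 at hl
    rw [h] at hl
    have h0 : v 0 ≠ 0 := by
      rintro h0; rw [h0] at hl; norm_num at hl
    apply Complex.ext <;> simp [dir, len2, h, h0]
  · rw [if_neg h, map_some, klein_coe]
    have hl' := hl.ne'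
    unfold len2 at hl'
    apply Complex.ext
    · simp only [dir, len2, Complex.normSq_ofReal]
      field_simp
    · simp only [dir, len2, Complex.normSq_ofReal, Complex.ofReal_re]
      field_simp

/-- The closed upper hemisphere. -/
def upper : Set (OnePoint ℂ) := range planeIncl ∪ range circleIncl

/-! ### The closed upper hemisphere and the disc -/

theorem coe_mem_upper {z : ℂ} : (z : OnePoint ℂ) ∈ upper ↔ 0 ≤ z.im := by
  constructor
  · rintro (⟨w, hw⟩ | ⟨y, hy⟩)
    · rw [planeIncl, OnePoint.coe_eq_coe] at hw
      rw [← hw]; exact w.im_pos.le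
    · induction y using OnePoint.rec with
      | infty => exact absurd hy (infty_ne_coe _)
      | coe t =>
        rw [circleIncl, map_some, OnePoint.coe_eq_coe] at hy
        rw [← hy]; simp
  · intro h
    rcases h.lt_or_eq with h | h
    · exact Or.inl ⟨⟨z, h⟩, rfl⟩
    · refine Or.inr ⟨(z.re : OnePoint ℝ), ?_⟩
      rw [circleIncl, map_some, OnePoint.coe_eq_coe]
      apply Complex.ext <;> simp [← h]

theorem infty_mem_upper : (∞ : OnePoint ℂ) ∈ upper := Or.inr ⟨∞, rfl⟩

theorem isClosed_upper : IsClosed upper := by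
  rw [← isOpen_compl_iff]
  have : upperᶜ = (fun z : ℂ => (z : OnePoint ℂ)) '' {z | z.im < 0} := by
    ext p
    induction p using OnePoint.rec with
    | infty => simp [infty_mem_upper]
    | coe z => simp [coe_mem_upper]
  rw [this]
  exact isOpenMap_coe _ (isOpen_lt Complex.continuous_im continuous_const)

/-- The image of z determines |z|² and re z, hence z up to complex conjugation. -/
theorem injOn_klein : InjOn klein upper := by
  have hinf : ∀ z : ℂ, klein z ≠ 1 := by
    intro z h
    have h1 := congrArg Complex.re h
    rw [klein_coe] at h1
    have := normSq_add_one_pos z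
    simp only [Complex.one_re] at h1
    rw [div_eq_one_iff_eq this.ne'] at h1
    linarith
  intro p hp p' hp' h
  induction p using OnePoint.rec with
  | infty =>
    induction p' using OnePoint.rec with
    | infty => rfl
    | coe z' => exact absurd h.symm (hinf z')
  | coe z =>
    induction p' using OnePoint.rec with
    | infty => exact absurd h (hinf z)
    | coe z' =>
      rw [coe_mem_upper] at hp hp'
      have h1 := congrArg Complex.re h
      have h2 := congrArg Complex.im h
      rw [klein_coe, klein_coe] at h1 h2
      have k1 := normSq_add_one_pos z
      have k2 := normSq_add_one_pos z'
      simp only at h1 h2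
      rw [div_eq_div_iff k1.ne' k2.ne'] at h1
      have e : Complex.normSq z = Complex.normSq z' := by linarith
      rw [e, div_left_inj' k2.ne'] at h2
      have hre : z.re = z'.re := by linarith
      rw [Complex.normSq_apply, Complex.normSq_apply, hre] at e
      have him : z.im = z'.im := by
        have : z.im ^ 2 = z'.im ^ 2 := by linarith
        exact (sq_eq_sq₀ hp hp').1 this
      rw [OnePoint.coe_eq_coe]
      exact Complex.ext hre him

/-- The inverse of the Klein map on the open disc. -/
def unklein (ξ : ℂ) : ℂ :=
  ⟨ξ.im / (1 - ξ.re), √(1 - (ξ.re ^ 2 + ξ.im ^ 2)) / (1 - ξ.re)⟩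

theorem one_sub_re_pos {ξ : ℂ} (h : ‖ξ‖ < 1) : 0 < 1 - ξ.re := by
  have := (Complex.re_le_norm ξ).trans_lt h
  linarith

theorem unklein_im_pos {ξ : ℂ} (h : ‖ξ‖ < 1) : 0 < (unklein ξ).im :=
  div_pos (Real.sqrt_pos.2 (by rw [norm_lt_one_iff] at h; linarith)) (one_sub_re_pos h)

theorem klein_unklein {ξ : ℂ} (h : ‖ξ‖ < 1) : klein (unklein ξ : ℂ) = ξ := by
  have h1 := (one_sub_re_pos h).ne'
  rw [norm_lt_one_iff] at h
  have e : Complex.normSq (unklein ξ) = (1 + ξ.re) / (1 - ξ.re) := by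
    rw [Complex.normSq_apply, unklein]
    simp only
    rw [div_mul_div_comm, div_mul_div_comm, Real.mul_self_sqrt (by linarith)]
    field_simp
    ring
  have e2 : (1 + ξ.re) / (1 - ξ.re) + 1 = 2 / (1 - ξ.re) := by field_simp; ring
  have e3 : (1 + ξ.re) / (1 - ξ.re) - 1 = 2 * ξ.re / (1 - ξ.re) := by field_simp; ring
  rw [klein_coe, e, e2, e3]
  apply Complex.ext
  · simp only; field_simp
  · simp only [unklein]; field_simp

theorem exists_upper {ξ : ℂ} (h : ‖ξ‖ ≤ 1) : ∃ p ∈ upper, klein p = ξ := by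
  rcases h.lt_or_eq with h | h
  · exact ⟨_, coe_mem_upper.2 (unklein_im_pos h).le, klein_unklein h⟩
  · obtain ⟨v, hv, rfl⟩ := exists_dir h
    exact ⟨_, Or.inr ⟨_, rfl⟩, klein_circleIncl_frac hv⟩

/-- The hemisphere is compact, so the injective continuous map to the disc is an embedding and
limits can be tested downstairs. -/
theorem tendsto_of_klein {α : Type*} {l : Filter α} {f : α → OnePoint ℂ} {p : OnePoint ℂ}
    (hf : ∀ a, f a ∈ upper) (hp : p ∈ upper)
    (h : Tendsto (fun a => klein (f a)) l (𝓝 (klein p))) : Tendsto f l (𝓝 p) := by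
  have hc : CompactSpace upper := isCompact_iff_compactSpace.1 isClosed_upper.isCompact
  have hemb : IsEmbedding (upper.domRestrict klein) :=
    ((continuous_klein.comp continuous_subtype_val).isClosedEmbedding
      (injOn_klein.injective)).isEmbedding
  have : Tendsto (fun a => (⟨f a, hf a⟩ : upper)) l (𝓝 ⟨p, hp⟩) :=
    hemb.tendsto_nhds_iff.2 h
  exact (continuous_subtype_val.tendsto _).comp this

theorem mem_closure_of_klein {A : Set ℂ} (hA : ∀ ξ ∈ A, ‖ξ‖ ≤ 1) {p : OnePoint ℂ}
    (hp : p ∈ upper) (h : klein p ∈ closure A) : p ∈ closure {p | p ∈ upper ∧ klein p ∈ A} := by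
  obtain ⟨x, hx, hlim⟩ := mem_closure_iff_seq_limit.1 h
  choose f hf hfk using fun n => exists_upper (hA _ (hx n))
  refine mem_closure_of_tendsto (tendsto_of_klein hf hp (l := atTop) ?_)
    (Eventually.of_forall fun n => ⟨hf n, by rw [hfk]; exact hx n⟩)
  simpa only [hfk] using hlim

theorem planeIncl_mem_upper (z : ℍ) : planeIncl z ∈ upper := Or.inl ⟨z, rfl⟩

theorem circleIncl_mem_upper (y : OnePoint ℝ) : circleIncl y ∈ upper := Or.inr ⟨y, rfl⟩

/-! ### Geodesics and triangles in the Klein model -/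

theorem exists_hcoord_frac {u : Fin 2 → ℝ} (hu : u ≠ 0) :
    ∃ c : ℝ, c ≠ 0 ∧ hcoord (frac u) 0 = c * u 0 ∧ hcoord (frac u) 1 = c * u 1 := by
  unfold frac
  by_cases h : u 1 = 0
  · have h0 : u 0 ≠ 0 := by
      intro h0; apply hu; ext i; fin_cases i <;> simp [h, h0]
    refine ⟨(u 0)⁻¹, inv_ne_zero h0, ?_, ?_⟩ <;> simp [h, h0, hcoord]
  · refine ⟨(u 1)⁻¹, inv_ne_zero h, ?_, ?_⟩
    · simp [h, hcoord]; ring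
    · simp [h, hcoord]

/-- Homogeneous coordinates are defined only up to scalars c and e of unknown sign. They are exposed
so that they can cancel against the determinants in `halfPlane`. -/
theorem exists_sideForm {u v : Fin 2 → ℝ} (hu : u ≠ 0) (hv : v ≠ 0) :
    ∃ c e : ℝ, c ≠ 0 ∧ e ≠ 0 ∧ (∀ i, hcoord (frac u) i = c * u i) ∧
      (∀ i, hcoord (frac v) i = e * v i) ∧ ∀ z : ℂ, sideForm (frac u) (frac v) z =
        c * e * (qf u v (klein z) * ((Complex.normSq z + 1) / 2)) := by
  obtain ⟨c, hc, h1, h2⟩ := exists_hcoord_frac hu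
  obtain ⟨e, he, h3, h4⟩ := exists_hcoord_frac hv
  refine ⟨c, e, hc, he, fun i => by fin_cases i <;> assumption,
    fun i => by fin_cases i <;> assumption, fun z => ?_⟩
  rw [qf_klein, sideForm, h1, h2, h3, h4, Complex.normSq_apply]
  simp
  ring

theorem mem_geodesic_frac {u v : Fin 2 → ℝ} (hu : u ≠ 0) (hv : v ≠ 0) (z : ℍ) :
    z ∈ geodesic (frac u) (frac v) ↔ qf u v (klein (planeIncl z)) = 0 := by
  obtain ⟨c, e, hc, he, -, -, h⟩ := exists_sideForm hu hv
  change sideForm _ _ _ = 0 ↔ _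
  rw [h]
  have := (normSq_add_one_pos (z : ℂ)).ne'
  simp [hc, he, this, planeIncl]

theorem mem_halfPlane_frac {u v w : Fin 2 → ℝ} (hu : u ≠ 0) (hv : v ≠ 0) (hw : w ≠ 0) (z : ℍ) :
    z ∈ halfPlane (frac u) (frac v) (frac w) ↔
      0 ≤ qf u v (klein (planeIncl z)) * (dt u w * dt v w) := by
  obtain ⟨c, e, hc, he, h1, h2, h⟩ := exists_sideForm hu hv
  obtain ⟨f, -, hf, -, h3, -, -⟩ := exists_sideForm hw hu
  change 0 ≤ sideForm _ _ _ * _ ↔ _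
  have hp := normSq_add_one_pos (z : ℂ)
  have key : sideForm (frac u) (frac v) z * (pdet (frac u) (frac w) * pdet (frac v) (frac w)) =
      ((c * e * f) ^ 2 * ((Complex.normSq (z : ℂ) + 1) / 2)) *
        (qf u v (klein (planeIncl z)) * (dt u w * dt v w)) := by
    rw [h]
    simp only [pdet, h1, h2, h3, dt, planeIncl]
    ring
  rw [key]
  exact mul_nonneg_iff_of_pos_left (by positivity)

theorem mem_idealTriangle {s : State} (hs : 0 < dt s.1 s.2) (z : ℍ) :
    z ∈ idealTriangle (frac s.1) (frac (s.1 + s.2)) (frac s.2) ↔ Tri s (klein (planeIncl z)) := by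
  have hu := ne_zero_of_dt_left hs.ne'
  have hw := ne_zero_of_dt_right hs.ne'
  have hm : s.1 + s.2 ≠ 0 := by
    apply ne_zero_of_dt_right (u := s.1)
    rw [dt_add_right, dt_self, zero_add]; exact hs.ne'
  rw [idealTriangle, mem_inter_iff, mem_inter_iff, mem_halfPlane_frac hu hm hw,
    mem_halfPlane_frac hm hw hu, mem_halfPlane_frac hw hu hm]
  simp only [dt_add_left, dt_add_right, dt_self, dt_swap s.2 s.1, add_zero, zero_add, neg_mul_neg]
  have h2 : 0 < dt s.1 s.2 * dt s.1 s.2 := mul_pos hs hs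
  rw [mul_nonneg_iff_of_pos_right h2, mul_nonneg_iff_of_pos_right h2, neg_mul, mul_neg,
    neg_nonneg, Tri, qf_comm (s.1 + s.2), qf_comm s.2 s.1]
  constructor
  · rintro ⟨⟨h3, h4⟩, h5⟩
    exact ⟨nonpos_of_mul_nonpos_left h5 h2, h3, h4⟩
  · rintro ⟨h3, h4, h5⟩
    exact ⟨⟨h4, h5⟩, mul_nonpos_of_nonpos_of_nonneg h3 h2.le⟩

/-! ### The defined sets in the Klein model -/

theorem IsEdge.exists_edge {q : ℝ} (hq : 0 < q) {u v : Fin 2 → ℝ} {j : ℤ} (h : IsEdge q u v j) :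
    ∃ b l, edge q b l = (u, q ^ (j + 1) • v) := by
  induction h with
  | pos => exact ⟨true, [], by simp [edge_nil, root]⟩
  | neg => exact ⟨false, [], by simp [edge_nil, root]⟩
  | left h ih =>
    obtain ⟨b, l, e⟩ := ih
    exact ⟨b, l ++ [false], by rw [edge_snoc, e, step_false]; simp⟩
  | right h ih =>
    obtain ⟨b, l, e⟩ := ih
    exact ⟨b, l ++ [true], by
      rw [edge_snoc, e, step_true]; simp only [smul_smul]; rw [zpow_add_one₀ hq.ne' (_ + 1), mul_comm]⟩

theorem exists_isEdge {q : ℝ} (hq : 0 < q) (b : Bool) (l : List Bool) :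
    ∃ v j, IsEdge q (edge q b l).1 v j ∧ (edge q b l).2 = q ^ (j + 1) • v := by
  induction l using List.reverseRecOn with
  | nil =>
    cases b
    · exact ⟨_, -1, IsEdge.neg, by simp [edge_nil, root]⟩
    · exact ⟨_, -1, IsEdge.pos, by simp [edge_nil, root]⟩
  | append_singleton l d ih =>
    obtain ⟨v, j, h, e⟩ := ih
    rw [edge_snoc]
    cases d
    · exact ⟨_, _, IsEdge.left h, by rw [step_false, e]; simp⟩
    · refine ⟨_, _, by rw [step_true, e]; exact IsEdge.right h, ?_⟩
      rw [step_true, e, smul_smul, zpow_add_one₀ hq.ne' (_ + 1), mul_comm]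

theorem mem_region {q : ℝ} (hq : 0 < q) (z : ℍ) :
    z ∈ region q ↔ klein (planeIncl z) ∈ kleinRegion q := by
  constructor
  · rintro ⟨u, v, j, h, hz⟩
    obtain ⟨b, l, e⟩ := h.exists_edge hq
    refine ⟨norm_klein_planeIncl z, b, l, ?_⟩
    rw [← mem_idealTriangle (dt_edge_pos hq b l), e]
    simpa only [frac_smul_const (zpow_pos hq (j + 1)).ne'] using hz
  · rintro ⟨-, b, l, h⟩
    obtain ⟨v, j, he, e⟩ := exists_isEdge hq b l
    refine ⟨_, v, j, he, ?_⟩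
    rw [← mem_idealTriangle (dt_edge_pos hq b l), e] at h
    simpa only [frac_smul_const (zpow_pos hq (j + 1)).ne'] using h

theorem klein_circleIncl_norm (y : OnePoint ℝ) : ‖klein (circleIncl y)‖ = 1 := by
  obtain ⟨v, hv, rfl⟩ := exists_frac y
  rw [klein_circleIncl_frac hv, norm_dir hv]

theorem sphereRegion_eq {q : ℝ} (hq : 0 < q) :
    sphereRegion q = {p | p ∈ upper ∧ klein p ∈ kleinRegion q} := by
  ext p
  constructor
  · rintro ⟨z, hz, rfl⟩
    exact ⟨planeIncl_mem_upper z, (mem_region hq z).1 hz⟩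
  · rintro ⟨⟨z, rfl⟩ | ⟨y, rfl⟩, h⟩
    · exact ⟨z, (mem_region hq z).2 h, rfl⟩
    · exact absurd (klein_circleIncl_norm y) h.1.ne

theorem rationalPart_eq {q : ℝ} (hq : 0 < q) (hq1 : q ≤ 1) :
    rationalPart q = {p | p ∈ upper ∧ klein p ∈ kleinRat q} := by
  ext p
  rw [rationalPart, mem_iUnion]
  constructor
  · rintro ⟨x, hx⟩
    obtain ⟨b, l, h, -⟩ := exists_word x
    obtain ⟨h1, h2⟩ := h q hq hq1
    have hw := snd_ne_zero hq b l
    have hf := flat_ne_zero (q := q) (dt_edge_pos hq b l)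
    rw [ratCurve, h1, h2] at hx
    rcases hx with ⟨z, hz, rfl⟩ | ⟨y, rfl | rfl, rfl⟩
    · refine ⟨planeIncl_mem_upper z, (norm_klein_planeIncl z).le, b, l, ?_⟩
      rw [qf_comm]
      exact (mem_geodesic_frac hf hw z).1 hz
    · refine ⟨circleIncl_mem_upper _, norm_klein_le _, b, l, ?_⟩
      rw [klein_circleIncl_frac hf, qf_dir_eq_zero hf, dt_self, mul_zero]
    · refine ⟨circleIncl_mem_upper _, norm_klein_le _, b, l, ?_⟩
      rw [klein_circleIncl_frac hw, qf_dir_eq_zero hw, dt_self, zero_mul]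
  · rintro ⟨hp, -, b, l, h⟩
    obtain ⟨x, hx⟩ := exists_rat_curve b l
    obtain ⟨h1, h2⟩ := hx q hq hq1
    have hw := snd_ne_zero hq b l
    have hf := flat_ne_zero (q := q) (dt_edge_pos hq b l)
    refine ⟨x, ?_⟩
    rw [ratCurve, h1, h2]
    rcases hp with ⟨z, rfl⟩ | ⟨y, rfl⟩
    · rw [qf_comm] at h
      exact Or.inl ⟨z, (mem_geodesic_frac hf hw z).2 h, rfl⟩
    · right
      refine ⟨y, ?_, rfl⟩
      obtain ⟨v, hv, rfl⟩ := exists_frac y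
      rw [klein_circleIncl_frac hv, qf_dir_eq_zero hv] at h
      rcases mul_eq_zero.1 h with h | h
      · right; exact (frac_eq_of_dt hw hv h).symm
      · left; exact (frac_eq_of_dt hf hv h).symm

/-! ### Irrational points -/

/-- The identification of `ℝ ∪ {∞}` with the ideal boundary of the Klein model. -/
def circ (y : OnePoint ℝ) : ℂ := klein (circleIncl y)

theorem circ_frac {v : Fin 2 → ℝ} (hv : v ≠ 0) : circ (frac v) = dir v := klein_circleIncl_frac hv

theorem continuous_circleIncl : Continuous circleIncl := by
  refine continuous_map Complex.continuous_ofReal ?_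
  rw [coclosedCompact_eq_cocompact, coclosedCompact_eq_cocompact]
  exact Complex.isometry_ofReal.isClosedEmbedding.tendsto_cocompact

theorem continuous_circ : Continuous circ := continuous_klein.comp continuous_circleIncl

theorem circleIncl_injective : Function.Injective circleIncl := by
  intro x y h
  induction x using OnePoint.rec <;> induction y using OnePoint.rec
  · rfl
  · exact absurd h (infty_ne_coe _)
  · exact absurd h (coe_ne_infty _)
  · rw [circleIncl, circleIncl, map_some, map_some, OnePoint.coe_eq_coe] at h
    rw [Complex.ofReal_injective h]

theorem circ_injective : Function.Injective circ := fun x y h =>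
  circleIncl_injective (injOn_klein (circleIncl_mem_upper x) (circleIncl_mem_upper y) h)

theorem isEmbedding_circ : IsEmbedding circ :=
  (continuous_circ.isClosedEmbedding circ_injective).isEmbedding

theorem range_circ : range circ = Metric.sphere 0 1 := by
  ext ξ
  rw [mem_sphere_zero_iff_norm]
  constructor
  · rintro ⟨y, rfl⟩; exact klein_circleIncl_norm y
  · intro h
    obtain ⟨v, hv, rfl⟩ := exists_dir h
    exact ⟨frac v, circ_frac hv⟩

theorem circ_rightRat_mem {q : ℝ} (hq : 0 < q) (hq1 : q ≤ 1) (x : OnePoint ℚ) :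
    circ (rightRat q x) ∈ kleinRat q := by
  obtain ⟨b, l, h, -⟩ := exists_word x
  rw [(h q hq hq1).1, circ_frac (snd_ne_zero hq b l)]
  exact dir_snd_mem_kleinRat hq b l

theorem rightRat_one (x : OnePoint ℚ) :
    rightRat 1 x = OnePoint.map (fun r : ℚ => (r : ℝ)) x := by
  obtain ⟨b, l, -, h⟩ := exists_word x
  exact h

/-- At q = 1 there are no gaps and the hull is the whole disc. A boundary point is then rational or
the end of a wild path. -/
theorem circ_mem_kleinIrr_one {t : ℝ} (ht : Irrational t) : circ (t : OnePoint ℝ) ∈ kleinIrr 1 := by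
  obtain ⟨v, hv, e⟩ := exists_frac (t : OnePoint ℝ)
  have hn := klein_circleIncl_norm (t : OnePoint ℝ)
  have hH : circ (t : OnePoint ℝ) ∈ kleinHull 1 := by
    refine ⟨hn.le, fun b l => ?_⟩
    have : flat 1 (edge 1 b l) = (edge 1 b l).2 := by simp [flat]
    rw [this]
    exact qf_self_nonneg _ hn.le
  rcases kleinHull_subset one_pos le_rfl hH with h | ⟨-, b, l, h⟩ | h
  · exact absurd hn h.1.ne
  · exfalso
    have hfl : flat 1 (edge 1 b l) = (edge 1 b l).2 := by simp [flat]
    rw [hfl, e, circ_frac hv, qf_dir_eq_zero hv, mul_self_eq_zero] at h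
    have hx := frac_eq_of_dt (snd_ne_zero one_pos b l) hv h
    obtain ⟨x, hx'⟩ := exists_rat_of_word b l
    rw [hx, ← e] at hx'
    induction x using OnePoint.rec with
    | infty => exact absurd hx' (infty_ne_coe _)
    | coe r =>
      rw [map_some, OnePoint.coe_eq_coe] at hx'
      exact ht ⟨r, hx'⟩
  · exact h

/-- If the undeformed path of `t` is `p`, the deformed right rationals of the rational numbers near
`t` lie beyond the deformed edges of `p`. -/
theorem eventually_beyond {q : ℝ} (hq : 0 < q) (hq1 : q ≤ 1) {t : ℝ} {b : Bool} {p : ℕ → Bool}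
    (hp : Wild p) (h : Beyond 1 b p (circ (t : OnePoint ℝ))) (n : ℕ) :
    ∀ᶠ r : ℚ in comap (fun r : ℚ => (r : ℝ)) (𝓝 t),
      qf (edge q b (pre p n)).1 (edge q b (pre p n)).2 (circ (rightRat q (r : OnePoint ℚ))) ≤ 0 := by
  have hneg : qf (edge 1 b (pre p n)).1 (edge 1 b (pre p n)).2 (circ (t : OnePoint ℝ)) < 0 := by
    obtain ⟨v, hv, e⟩ := exists_frac (t : OnePoint ℝ)
    rw [e, circ_frac hv] at h ⊢
    rw [qf_dir_neg hv]
    exact h.dt_neg one_pos hp hv n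
  have hc : Continuous fun s : ℝ =>
      qf (edge 1 b (pre p n)).1 (edge 1 b (pre p n)).2 (circ (s : OnePoint ℝ)) :=
    (continuous_qf _ _).comp (continuous_circ.comp continuous_coe)
  filter_upwards [(hc.continuousAt.eventually (gt_mem_nhds hneg)).comap
    (fun r : ℚ => (r : ℝ))] with r hr
  obtain ⟨b', l, h1, h2⟩ := exists_word (r : OnePoint ℚ)
  rw [map_some, (h1 1 one_pos le_rfl).1] at h2
  rw [← h2, circ_frac (snd_ne_zero one_pos b' l), qf_dir_neg (snd_ne_zero one_pos b' l)] at hr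
  -- Near t the rational lies strictly beyond the undeformed edge, so its address extends the
  -- prefix. This fact about words holds for every q.
  obtain ⟨rfl, m, rfl⟩ := prefix_of_edge one_pos hr
  have hd := dt_edge_pos hq b (pre p n)
  have hI : InCone (edge q b (pre p n)) (edge q b (pre p n ++ m)).2 := by
    rw [edge_append]
    exact InCone.of_run hq (InCone.snd _)
  rw [(h1 q hq hq1).1, circ_frac (snd_ne_zero hq b _), qf_dir_nonpos (snd_ne_zero hq b _)]
  exact mul_nonpos_of_nonneg_of_nonpos (hI.dt_fst hd) (hI.dt_snd hd)

theorem comap_rat_neBot (t : ℝ) : (comap (fun r : ℚ => (r : ℝ)) (𝓝 t)).NeBot :=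
  Rat.isDenseEmbedding_coe_real.toIsDenseInducing.comap_nhds_neBot t

/-- A path which is not eventually constant has a limit in the undeformed tessellation. -/
theorem exists_beyond_one (b : Bool) (p : ℕ → Bool) : ∃ ξ, Beyond 1 b p ξ := by
  let K : ℕ → Set ℂ := fun n =>
    Metric.closedBall 0 1 ∩ {ξ | qf (edge 1 b (pre p n)).1 (edge 1 b (pre p n)).2 ξ ≤ 0}
  have hcl : ∀ n, IsClosed (K n) := fun n =>
    Metric.isClosed_closedBall.inter (isClosed_le (continuous_qf _ _) continuous_const)
  have hmono : ∀ n, K (n + 1) ⊆ K n := by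
    rintro n ξ ⟨h1, h2⟩
    refine ⟨h1, ?_⟩
    have hn : ‖ξ‖ ≤ 1 := by simpa using h1
    simp only [mem_ofPred_eq, edge_pre_succ] at h2 ⊢
    have k1 := qf_self_nonneg (edge 1 b (pre p n)).1 hn
    have k2 := qf_self_nonneg (edge 1 b (pre p n)).2 hn
    cases hpn : p n
    · rw [hpn, step_false, one_smul, qf_add_right] at h2; linarith
    · rw [hpn, step_true, one_smul, qf_add_left] at h2; linarith
  have hne : ∀ n, (K n).Nonempty := fun n => by
    have hw := snd_ne_zero one_pos b (pre p n)
    refine ⟨dir (edge 1 b (pre p n)).2, by simp [norm_dir hw], ?_⟩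
    rw [mem_ofPred_eq, qf_dir_nonpos hw, dt_self, mul_zero]
  obtain ⟨ξ, hξ⟩ := IsCompact.nonempty_iInter_of_sequence_nonempty_isCompact_isClosed K hmono hne
    ((isCompact_closedBall (0 : ℂ) 1).inter_right
      (isClosed_le (continuous_qf _ _) continuous_const)) hcl
  rw [mem_iInter] at hξ
  exact ⟨ξ, by simpa using (hξ 0).1, fun n => (hξ n).2⟩

/-- One path serves t at q = 1 and its deformation at q. Being beyond an edge is a closed condition,
which gives one direction; the shrinking of the edges gives convergence in the other. -/
theorem mem_irrationals {q : ℝ} (hq : 0 < q) (hq1 : q ≤ 1) (y : OnePoint ℝ) :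
    y ∈ irrationals q ↔ circ y ∈ kleinIrr q := by
  constructor
  · rintro ⟨t, y, ht, rfl, hlim⟩
    obtain ⟨b, p, hp, hB⟩ := circ_mem_kleinIrr_one ht
    refine ⟨b, p, hp, (klein_circleIncl_norm _).le, fun n => ?_⟩
    have := comap_rat_neBot t
    have hc : Continuous fun s : OnePoint ℝ =>
        qf (edge q b (pre p n)).1 (edge q b (pre p n)).2 (circ s) :=
      (continuous_qf _ _).comp continuous_circ
    exact le_of_tendsto ((hc.tendsto _).comp hlim) (eventually_beyond hq hq1 hp hB n)
  · rintro ⟨b, p, hp, hB⟩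
    obtain ⟨ξ, hξ⟩ := exists_beyond_one b p
    obtain ⟨x, rfl⟩ : ξ ∈ range circ := by
      rw [range_circ, mem_sphere_zero_iff_norm]
      exact hξ.norm_eq_one one_pos le_rfl hp.1
    have hx : ∀ r : OnePoint ℚ, x ≠ OnePoint.map (fun r : ℚ => (r : ℝ)) r := by
      rintro r rfl
      refine Set.disjoint_left.1 (disjoint_kleinRat_kleinIrr one_pos le_rfl) ?_ ⟨b, p, hp, hξ⟩
      rw [← rightRat_one]
      exact circ_rightRat_mem one_pos le_rfl r
    -- The point ∞ is the right vertex of the positive root, hence rational.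
    have hy : y ≠ ∞ := by
      rintro rfl
      refine Set.disjoint_left.1 (disjoint_kleinRat_kleinIrr hq hq1) ?_ ⟨b, p, hp, hB⟩
      have := dir_snd_mem_kleinRat hq true []
      rw [← circ_frac (snd_ne_zero hq true [])] at this
      simpa [edge_nil, root, frac_one_zero] using this
    induction y using OnePoint.rec with
    | infty => exact absurd rfl hy
    | coe y =>
    induction x using OnePoint.rec with
    | infty => exact absurd rfl (hx ∞)
    | coe t =>
    refine ⟨t, y, ?_, rfl, ?_⟩
    · rintro ⟨r, rfl⟩
      exact hx (r : OnePoint ℚ) rfl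
    · rw [isEmbedding_circ.tendsto_nhds_iff, Metric.tendsto_nhds]
      intro ε hε
      obtain ⟨n, hn⟩ := (exists_small hq hq1 b hp.1 (half_pos hε)).exists
      filter_upwards [eventually_beyond hq hq1 hp hξ n] with r hr
      have h1 := (norm_sub_dir_le hq (klein_circleIncl_norm _).le hr).2
      have h2 := (norm_sub_dir_le hq hB.1 (hB.2 n)).2
      rw [← dist_eq_norm] at h1 h2
      have := dist_triangle_right (circ (rightRat q (r : OnePoint ℚ))) (circ (y : OnePoint ℝ))
        (dir (edge q b (pre p n)).2)
      simp only [Function.comp_apply]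
      unfold circ at *
      linarith

theorem irrationalPart_eq {q : ℝ} (hq : 0 < q) (hq1 : q ≤ 1) :
    irrationalPart q = {p | p ∈ upper ∧ klein p ∈ kleinIrr q} := by
  ext p
  constructor
  · rintro ⟨y, hy, rfl⟩
    exact ⟨circleIncl_mem_upper y, (mem_irrationals hq hq1 y).1 hy⟩
  · rintro ⟨⟨z, rfl⟩ | ⟨y, rfl⟩, h⟩
    · obtain ⟨b, p, hp, hB⟩ := h
      exact absurd (hB.norm_eq_one hq hq1 hp.1) (norm_klein_planeIncl z).ne
    · exact ⟨y, (mem_irrationals hq hq1 y).2 h, rfl⟩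

/-! ### The closure of the region and its frontier -/

/-! ### Radial rescaling to the round disc -/

theorem kleinHull_mem_nhds_zero {q : ℝ} (hq : 0 < q) (hq1 : q ≤ 1) : kleinHull q ∈ 𝓝 0 := by
  rw [← mem_interior_iff_mem_nhds, interior_kleinHull hq hq1]
  exact zero_mem_kleinRegion

theorem isVonNBounded_kleinHull (q : ℝ) : Bornology.IsVonNBounded ℝ (kleinHull q) :=
  (NormedSpace.isVonNBounded_closedBall ℝ ℂ 1).subset fun ξ hξ => by simpa using hξ.1

/-- The radial map carrying the tessellated part of the Klein disc to the whole disc. -/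
def radial {q : ℝ} (hq : 0 < q) (hq1 : q ≤ 1) : ℂ ≃ₜ ℂ :=
  gaugeRescaleHomeomorph (kleinHull q) (Metric.closedBall 0 1) (convex_kleinHull q)
    (kleinHull_mem_nhds_zero hq hq1) (isVonNBounded_kleinHull q) (convex_closedBall 0 1)
    (Metric.closedBall_mem_nhds 0 one_pos) (NormedSpace.isVonNBounded_closedBall ℝ ℂ 1)

theorem image_radial_kleinRegion {q : ℝ} (hq : 0 < q) (hq1 : q ≤ 1) :
    radial hq hq1 '' kleinRegion q = Metric.ball 0 1 := by
  rw [← interior_kleinHull hq hq1, radial, image_gaugeRescaleHomeomorph_interior,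
    interior_closedBall _ one_ne_zero]

theorem image_radial_kleinHull {q : ℝ} (hq : 0 < q) (hq1 : q ≤ 1) :
    radial hq hq1 '' kleinHull q = Metric.closedBall 0 1 := by
  conv_lhs => rw [← (isClosed_kleinHull q).closure_eq]
  rw [radial, image_gaugeRescaleHomeomorph_closure, Metric.isClosed_closedBall.closure_eq]

theorem image_radial_frontier {q : ℝ} (hq : 0 < q) (hq1 : q ≤ 1) :
    radial hq hq1 '' frontier (kleinHull q) = Metric.sphere 0 1 := by
  rw [(isClosed_kleinHull q).frontier_eq, image_sdiff (radial hq hq1).injective,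
    interior_kleinHull hq hq1, image_radial_kleinHull, image_radial_kleinRegion,
    Metric.closedBall_sdiff_ball]

/-- The gauges of the hull and of the disc both equal 1 at a common frontier point, so the rescaling
factor there is 1. -/
theorem radial_eq_self {q : ℝ} (hq : 0 < q) (hq1 : q ≤ 1) {ξ : ℂ}
    (hξ : ξ ∈ frontier (kleinHull q)) (hn : ‖ξ‖ = 1) : radial hq hq1 ξ = ξ := by
  have h1 := (gauge_eq_one_iff_mem_frontier (convex_kleinHull q)
    (kleinHull_mem_nhds_zero hq hq1)).2 hξ
  have hs : ξ ∈ frontier (Metric.closedBall (0 : ℂ) 1) := by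
    rw [frontier_closedBall _ one_ne_zero]; simpa using hn
  have h2 := (gauge_eq_one_iff_mem_frontier (convex_closedBall (0 : ℂ) 1)
    (Metric.closedBall_mem_nhds 0 one_pos)).2 hs
  change gaugeRescale _ _ ξ = ξ
  rw [gaugeRescale_def, h1, h2, div_one, one_smul]

/-- The region is homeomorphic to its image in the Klein disc. -/
def regionHomeo {q : ℝ} (hq : 0 < q) : region q ≃ₜ kleinRegion q where
  toFun z := ⟨klein (planeIncl z), (mem_region hq _).1 z.2⟩
  invFun ξ := ⟨⟨unklein ξ, unklein_im_pos ξ.2.1⟩, (mem_region hq _).2 (by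
    have : klein (planeIncl ⟨unklein ξ, unklein_im_pos ξ.2.1⟩) = ξ := klein_unklein ξ.2.1
    rw [this]; exact ξ.2)⟩
  left_inv z := by
    have h := norm_klein_planeIncl (z : ℍ)
    have h1 : klein (unklein (klein (planeIncl z)) : ℂ) = klein (planeIncl z) := klein_unklein h
    have h2 := injOn_klein (coe_mem_upper.2 (unklein_im_pos h).le) (planeIncl_mem_upper z) h1
    rw [planeIncl, OnePoint.coe_eq_coe] at h2
    exact Subtype.ext (UpperHalfPlane.ext h2)
  right_inv ξ := Subtype.ext (klein_unklein ξ.2.1)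
  continuous_toFun := by
    refine Continuous.subtype_mk (continuous_klein.comp ?_) _
    exact continuous_coe.comp (UpperHalfPlane.continuous_coe.comp continuous_subtype_val)
  continuous_invFun := by
    refine Continuous.subtype_mk ?_ _
    rw [UpperHalfPlane.isEmbedding_coe.continuous_iff]
    change Continuous fun ξ : kleinRegion q => unklein ξ
    have hne : ∀ ξ : kleinRegion q, 1 - (ξ : ℂ).re ≠ 0 := fun ξ => (one_sub_re_pos ξ.2.1).ne'
    have hre : Continuous fun ξ : kleinRegion q => (ξ : ℂ).re :=
      Complex.continuous_re.comp continuous_subtype_val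
    have him : Continuous fun ξ : kleinRegion q => (ξ : ℂ).im :=
      Complex.continuous_im.comp continuous_subtype_val
    have : (fun ξ : kleinRegion q => unklein ξ) = fun ξ : kleinRegion q =>
        Complex.equivRealProdCLM.symm ((ξ : ℂ).im / (1 - (ξ : ℂ).re),
          √(1 - ((ξ : ℂ).re ^ 2 + (ξ : ℂ).im ^ 2)) / (1 - (ξ : ℂ).re)) := by
      ext ξ
      apply Complex.ext <;> simp [unklein]
    rw [this]
    refine (ContinuousLinearEquiv.continuous _).comp (Continuous.prodMk ?_ ?_)
    · exact him.div (continuous_const.sub hre) hne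
    · exact (Real.continuous_sqrt.comp (continuous_const.sub ((hre.pow 2).add (him.pow 2)))).div
        (continuous_const.sub hre) hne

theorem nonempty_homeomorph_ball {q : ℝ} (hq : 0 < q) (hq1 : q ≤ 1) :
    Nonempty (region q ≃ₜ Metric.ball (0 : ℂ) 1) :=
  ⟨(regionHomeo hq).trans (((radial hq hq1).image _).trans
    (Homeomorph.setCongr (image_radial_kleinRegion hq hq1)))⟩

theorem region_ne_univ {q : ℝ} (hq : 0 < q) (hq1 : q < 1) : region q ≠ univ := by
  intro h
  -- This point lies on the rational curve of ∞, the vertical line over 1 / (1 - q).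
  let z : ℍ := ⟨⟨1 / (1 - q), 1⟩, by simp⟩
  have hz : klein (planeIncl z) ∈ kleinRegion q := (mem_region hq z).1 (h ▸ mem_univ z)
  refine disjoint_interior hq hq1.le (ξ := klein (planeIncl z))
    (by rwa [interior_kleinHull hq hq1.le]) (Or.inl ⟨norm_klein_le _, true, [], ?_⟩)
  have hp := normSq_add_one_pos (z : ℂ)
  have e := qf_klein (edge q true []).2 (flat q (edge q true [])) (z : ℂ)
  have hq' : 1 - q ≠ 0 := by linarith
  have hre : (z : ℂ).re = 1 / (1 - q) := rfl
  rw [hre] at e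
  simp only [edge_nil, root_true, flat, Pi.add_apply, Pi.smul_apply, Matrix.cons_val_zero,
    Matrix.cons_val_one, smul_eq_mul] at e ⊢
  have e0 : (0 : ℝ) * ((1 - q) * 1 + 0) * Complex.normSq (z : ℂ) -
      (1 * ((1 - q) * 1 + 0) + 0 * ((1 - q) * 0 + 1)) * (1 / (1 - q)) +
      1 * ((1 - q) * 0 + 1) = 0 := by
    field_simp
    ring
  rw [e0] at e
  exact (mul_eq_zero.1 e).resolve_right (by positivity)

/-! ### Closure and frontier in the Riemann sphere -/

/-- A closed convex set with nonempty interior is the closure of that interior. -/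
theorem closure_sphereRegion {q : ℝ} (hq : 0 < q) (hq1 : q ≤ 1) :
    closure (sphereRegion q) = {p | p ∈ upper ∧ klein p ∈ kleinHull q} := by
  rw [sphereRegion_eq hq]
  apply Subset.antisymm
  · refine closure_minimal (fun p hp => ⟨hp.1, kleinRegion_subset_kleinHull hq hq1 hp.2⟩) ?_
    exact isClosed_upper.inter ((isClosed_kleinHull q).preimage continuous_klein)
  · rintro p ⟨hp, h⟩
    refine mem_closure_of_klein (fun ξ hξ => hξ.1.le) hp ?_
    rw [← interior_kleinHull hq hq1, (convex_kleinHull q).closure_interior_eq_closure_of_nonempty_interior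
      ⟨0, mem_interior_iff_mem_nhds.2 (kleinHull_mem_nhds_zero hq hq1)⟩]
    exact subset_closure h

theorem circleIncl_mem_closure_compl_upper (y : OnePoint ℝ) : circleIncl y ∈ closure upperᶜ := by
  induction y using OnePoint.rec with
  | infty =>
    have h : Tendsto (fun s : ℝ => (((-s : ℝ) * Complex.I : ℂ) : OnePoint ℂ)) atTop (𝓝 ∞) := by
      refine tendsto_coe_infty.comp ?_
      rw [coclosedCompact_eq_cocompact, ← Metric.cobounded_eq_cocompact,
        ← tendsto_norm_atTop_iff_cobounded]
      simpa using tendsto_abs_atTop_atTop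
    refine mem_closure_of_tendsto h ?_
    filter_upwards [eventually_gt_atTop 0] with s hs
    rw [mem_compl_iff, coe_mem_upper]
    simpa using hs
  | coe t =>
    have h : Tendsto (fun s : ℝ => (((t : ℂ) - s * Complex.I : ℂ) : OnePoint ℂ)) (𝓝[>] 0)
        (𝓝 (circleIncl t)) := by
      have hc : Continuous fun s : ℝ => (((t : ℂ) - s * Complex.I : ℂ) : OnePoint ℂ) :=
        continuous_coe.comp (by fun_prop)
      have := hc.tendsto 0
      simp only [Complex.ofReal_zero, zero_mul, sub_zero] at this
      exact this.mono_left nhdsWithin_le_nhds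
    refine mem_closure_of_tendsto h ?_
    filter_upwards [self_mem_nhdsWithin] with s hs
    rw [mem_compl_iff, coe_mem_upper]
    simpa using hs

theorem isOpen_sphereRegion {q : ℝ} (hq : 0 < q) : IsOpen (sphereRegion q) := by
  have : sphereRegion q = (fun z : ℂ => (z : OnePoint ℂ)) ''
      ({z | 0 < z.im} ∩ (fun z : ℂ => klein z) ⁻¹' kleinRegion q) := by
    ext p
    constructor
    · rintro ⟨z, hz, rfl⟩
      exact ⟨z, ⟨z.im_pos, (mem_region hq z).1 hz⟩, rfl⟩
    · rintro ⟨z, ⟨h1, h2⟩, rfl⟩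
      exact ⟨⟨z, h1⟩, (mem_region hq _).2 h2, rfl⟩
  rw [this]
  exact isOpenMap_coe _ ((isOpen_lt continuous_const Complex.continuous_im).inter
    ((isOpen_kleinRegion hq).preimage (continuous_klein.comp continuous_coe)))

/-- The interior is taken in the sphere, not in the hemisphere. Ideal points are excluded as limits
from the lower half plane, and at points of the upper half plane the question passes to the open
disc. -/
theorem interior_closure_sphereRegion {q : ℝ} (hq : 0 < q) (hq1 : q ≤ 1) :
    interior (closure (sphereRegion q)) = sphereRegion q := by
  apply Subset.antisymm
  · intro p hp
    have hpc := interior_subset hp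
    rw [closure_sphereRegion hq hq1] at hp hpc
    have hup : p ∉ closure upperᶜ := by
      intro h
      rw [closure_compl] at h
      exact h (interior_mono (fun p hp => hp.1) hp)
    obtain ⟨hpu, hpk⟩ := hpc
    rw [sphereRegion_eq hq]
    refine ⟨hpu, ?_⟩
    rcases hpu with ⟨z, rfl⟩ | ⟨y, rfl⟩
    swap
    · exact absurd (circleIncl_mem_closure_compl_upper y) hup
    have hn := norm_klein_planeIncl z
    rw [← interior_kleinHull hq hq1, mem_interior_iff_mem_nhds]
    by_contra hc
    -- Points outside the hull accumulating in the disc lift to points outside the closure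
    -- accumulating at z.
    have hcl : klein (planeIncl z) ∈ closure (Metric.closedBall 0 1 \ kleinHull q) := by
      rw [mem_closure_iff_nhds]
      intro U hU
      by_contra hempty
      apply hc
      filter_upwards [hU, Metric.closedBall_mem_nhds_of_mem (mem_ball_zero_iff.2 hn)] with ξ h1 h2
      by_contra h3
      exact hempty ⟨ξ, h1, h2, h3⟩
    have h2 := mem_closure_of_klein (fun ξ hξ => by simpa using hξ.1) (planeIncl_mem_upper z) hcl
    obtain ⟨p, hp1, hp2⟩ := mem_closure_iff_nhds.1 h2 _ (mem_interior_iff_mem_nhds.1 hp)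
    exact hp2.2.2 hp1.2
  · exact interior_maximal subset_closure (isOpen_sphereRegion hq)

theorem rationalPart_union_irrationalPart {q : ℝ} (hq : 0 < q) (hq1 : q ≤ 1) :
    rationalPart q ∪ irrationalPart q = {p | p ∈ upper ∧ klein p ∈ frontier (kleinHull q)} := by
  rw [rationalPart_eq hq hq1, irrationalPart_eq hq hq1, frontier_kleinHull hq hq1]
  ext p
  simp only [mem_union, mem_ofPred_eq, and_or_left]

theorem closure_diff_sphereRegion {q : ℝ} (hq : 0 < q) (hq1 : q ≤ 1) :
    closure (sphereRegion q) \ sphereRegion q = rationalPart q ∪ irrationalPart q := by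
  rw [rationalPart_union_irrationalPart hq hq1, closure_sphereRegion hq hq1, sphereRegion_eq hq,
    (isClosed_kleinHull q).frontier_eq, interior_kleinHull hq hq1]
  ext p
  simp only [Set.mem_sdiff, mem_ofPred_eq]
  tauto

theorem frontier_closure_sphereRegion {q : ℝ} (hq : 0 < q) (hq1 : q ≤ 1) :
    frontier (closure (sphereRegion q)) = rationalPart q ∪ irrationalPart q := by
  rw [isClosed_closure.frontier_eq, interior_closure_sphereRegion hq hq1,
    closure_diff_sphereRegion hq hq1]

/-- The boundary goes to the frontier of the hull by `klein`, radially to the unit circle, and back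
to ℝ ∪ {∞} by the inverse of `circ`. The radial map fixes the ideal points, so the composite is the
identity on them. -/
theorem exists_boundary_homeomorph {q : ℝ} (hq : 0 < q) (hq1 : q ≤ 1) :
    ∃ Φ : ↥(rationalPart q ∪ irrationalPart q) ≃ₜ OnePoint ℝ,
      ∀ (p : ↥(rationalPart q ∪ irrationalPart q)) (x : OnePoint ℝ),
        (p : OnePoint ℂ) = circleIncl x → Φ p = x := by
  have hB := rationalPart_union_irrationalPart hq hq1
  set B := rationalPart q ∪ irrationalPart q
  have hcpt : CompactSpace B := by
    rw [← isCompact_iff_compactSpace, hB]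
    exact (isClosed_upper.inter (isClosed_frontier.preimage continuous_klein)).isCompact
  let f : B → ℂ := fun p => radial hq hq1 (klein p)
  have hf : Continuous f :=
    (radial hq hq1).continuous.comp (continuous_klein.comp continuous_subtype_val)
  have hmem : ∀ p : B, (p : OnePoint ℂ) ∈ upper ∧ klein p ∈ frontier (kleinHull q) := fun p =>
    hB.subset p.2
  have hinj : Function.Injective f := fun p p' h =>
    Subtype.ext (injOn_klein (hmem p).1 (hmem p').1 ((radial hq hq1).injective h))
  have hemb : IsEmbedding f := (hf.isClosedEmbedding hinj).isEmbedding
  have hrange : range f = range circ := by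
    rw [range_circ, ← image_radial_frontier hq hq1]
    ext ξ
    constructor
    · rintro ⟨p, rfl⟩
      exact ⟨_, (hmem p).2, rfl⟩
    · rintro ⟨η, hη, rfl⟩
      obtain ⟨p, hp, rfl⟩ := exists_upper ((isClosed_kleinHull q).frontier_subset hη).1
      exact ⟨⟨p, hB.superset ⟨hp, hη⟩⟩, rfl⟩
  refine ⟨hemb.toHomeomorph.trans ((Homeomorph.setCongr hrange).trans
    isEmbedding_circ.toHomeomorph.symm), fun p x hx => ?_⟩
  rw [Homeomorph.trans_apply, Homeomorph.trans_apply, Homeomorph.symm_apply_eq]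
  apply Subtype.ext
  change radial hq hq1 (klein p) = circ x
  have h := (hmem p).2
  rw [hx] at h ⊢
  exact radial_eq_self hq hq1 h (klein_circleIncl_norm x)

theorem frontier_subset_closure_rationalPart {q : ℝ} (hq : 0 < q) (hq1 : q ≤ 1) :
    rationalPart q ∪ irrationalPart q ⊆ closure (rationalPart q) := by
  refine union_subset subset_closure ?_
  rw [irrationalPart_eq hq hq1, rationalPart_eq hq hq1]
  rintro p ⟨hp, h⟩
  exact mem_closure_of_klein (fun ξ hξ => hξ.1) hp (kleinIrr_subset_closure hq hq1 h)

theorem disjoint_rationalPart_irrationalPart {q : ℝ} (hq : 0 < q) (hq1 : q ≤ 1) :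
    Disjoint (rationalPart q) (irrationalPart q) := by
  rw [irrationalPart_eq hq hq1, rationalPart_eq hq hq1, Set.disjoint_left]
  rintro p ⟨-, h1⟩ ⟨-, h2⟩
  exact Set.disjoint_left.1 (disjoint_kleinRat_kleinIrr hq hq1) h1 h2

end QFarey

end

theorem proposition2p8 (q : ℝ) (hq0 : 0 < q) (hq1 : q ≤ 1) :
    -- the region is an open disk, and a proper part of the plane if `q < 1`
    Nonempty (QFarey.region q ≃ₜ Metric.ball (0 : ℂ) 1) ∧
    (q < 1 → QFarey.region q ≠ Set.univ) ∧
    -- the boundary of its closure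
    frontier (closure (QFarey.sphereRegion q)) =
      QFarey.rationalPart q ∪ QFarey.irrationalPart q ∧
    closure (QFarey.sphereRegion q) \ QFarey.sphereRegion q =
      QFarey.rationalPart q ∪ QFarey.irrationalPart q ∧
    Disjoint (QFarey.rationalPart q) (QFarey.irrationalPart q) ∧
    -- the boundary is a circle
    (∃ Φ : ↥(QFarey.rationalPart q ∪ QFarey.irrationalPart q) ≃ₜ OnePoint ℝ,
      ∀ (p : ↥(QFarey.rationalPart q ∪ QFarey.irrationalPart q)) (x : OnePoint ℝ),
        x ∈ Set.range (QFarey.leftRat q) ∪ Set.range (QFarey.rightRat q) ∪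
          QFarey.irrationals q →
        (p : OnePoint ℂ) = QFarey.circleIncl x → Φ p = x) ∧
    Nonempty (↥(frontier (closure (QFarey.sphereRegion q))) ≃ₜ OnePoint ℝ) ∧
    -- the rational curves are dense in the boundary
    QFarey.rationalPart q ⊆ frontier (closure (QFarey.sphereRegion q)) ∧
    frontier (closure (QFarey.sphereRegion q)) ⊆ closure (QFarey.rationalPart q) := by
  have hF := QFarey.frontier_closure_sphereRegion hq0 hq1
  obtain ⟨Φ, hΦ⟩ := QFarey.exists_boundary_homeomorph hq0 hq1
  exact ⟨QFarey.nonempty_homeomorph_ball hq0 hq1, QFarey.region_ne_univ hq0, hF,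
    QFarey.closure_diff_sphereRegion hq0 hq1, QFarey.disjoint_rationalPart_irrationalPart hq0 hq1,
    ⟨Φ, fun p x _ hp => hΦ p x hp⟩, ⟨(Homeomorph.setCongr hF).trans Φ⟩,
    hF.symm ▸ Set.subset_union_left,
    hF.symm ▸ QFarey.frontier_subset_closure_rationalPart hq0 hq1⟩
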